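/- **Corollary 3.10 (The Invariance Theorem).** Let $k$ be a commutative ring, $\mathcal C$ a small category and $\mathbb A:\mathcal C^{op}\to k\text{-}\mathbf{alg}$ a diagram (presheaf) of associative unital $k$-algebras, with values $\mathbb A^i$ and restriction maps $\varphi^v:\mathbb A^{j}\to\mathbb A^{i}$ for $v:i\to j$. A (left) $\mathbb A$-module $\mathbb M$ is a presheaf of abelian groups on $\mathcal C$ with an $\mathbb A^i$-module structure on each $\mathbb M^i$ such that for each $v:i\to j$ the restriction map $\mathbb M^{j}\to\mathbb M^{i}$ is $\mathbb A^{j}$-linear, where $\mathbb A^j$ acts on $\mathbb M^i$ through $\varphi^v$; a map of $\mathbb A$-modules is a natural transformation that is objectwise $\mathbb A^i$-linear. A map $\eta:\mathbb M\to\mathbb N$ is *allowable* if for every object $i$ of $\mathcal C$ there is a $k$-linear map $s^i:\mathbb N^i\to\mathbb M^i$ (not required to be natural in $i$) with $\eta^i s^i\eta^i=\eta^i$. The relative Yoneda cohomology $\mathrm{Ext}^n_{\mathbb A,k}(\mathbb M,\mathbb N)$ is $\mathrm{Hom}_{\mathbb A}(\mathbb M,\mathbb N)$ for $n=0$, and for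 $n\ge 1$ it is the $k$-module, under Baer sum, of exact sequences $0\to\mathbb N\to\mathbb E_{n-1}\to\cdots\to\mathbb E_0\to\mathbb M\to0$ of $\mathbb A$-modules in which all maps are allowable, modulo the equivalence relation generated by the morphisms of such sequences that are the identity on $\mathbb N$ and on $\mathbb M$. The *subdivision* $\mathcal C'$ of $\mathcal C$ is the category whose objects are the simplices of $\mathcal C$, i.e. the functors $\tau:[p]=\{0<\dots<p\}\to\mathcal C$ ($p\ge0$). A map from $\tau:[p]\to\mathcal C$ to $\sigma:[q]\to\mathcal C$ is a triple $[\tau,\sigma,v]$, with $v:\tau(0)\to\sigma(0)$ a map of $\mathcal C$ for which there is a strictly increasing $f:[q]\to[p]$ with $\sigma=\tau\circ f$ and $v=\tau(0\to f(0))$; composition is composition of the third entries. Let $\mathbf d:\mathcal C'\to\mathcal C$ be the functor $\mathbf d\tau=\tau(0)$, $\mathbf d[\tau,\sigma,v]=v$. Put $\mathbb A'=\mathbf d^*\mathbb A$, so $(\mathbb A')^\tau=\mathbb A^{\tau(0)}$, and for an $\mathbb A$-module $\mathbb M$ let $\mathbb M'=\mathbf d^*\mathbb M$ be the $\mathbb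 A'$-module with $(\mathbb M')^\tau=\mathbb M^{\tau(0)}$. The functor $\mathbf d^*:\mathbb M\mapsto\mathbb M'$ is exact and preserves allowable maps. Then for all $n\ge0$ and all $\mathbb A$-modules $\mathbb M,\mathbb N$ the map induced by $\mathbf d^*$, $$\mathrm{Ext}^n_{\mathbb A,k}(\mathbb M,\mathbb N)\longrightarrow\mathrm{Ext}^n_{\mathbb A',k}(\mathbb M',\mathbb N'),\qquad [\mathcal E]\longmapsto[\mathcal E'],$$ (for $n=0$: $\eta\mapsto\mathbf d^*\eta$) is an isomorphism of $k$-modules, and it is natural in $\mathbb M$ and in $\mathbb N$. -/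

import Mathlib

open CategoryTheory CategoryTheory.Limits Opposite

set_option linter.unusedSectionVars false

noncomputable section

namespace RelYoneda

open scoped ZeroObject

universe v v' v₁ u u' u₁ w w'

section Generic

variable {𝒜 : Type u} [Category.{v} 𝒜] [Abelian 𝒜] {ℬ : Type u'} [Category.{v'} ℬ] [Abelian ℬ]
  {ι : Type w}

/-- A morphism `f` is allowable relative to a family `U` of functors when each `U i` sends it to a
morphism which has a splitting map `s`, i.e. `f s f = f` after applying `U i`.  The splitting maps
are not required to be compatible with each other. -/
def Allowable (U : ι → 𝒜 ⥤ ℬ) {X Y : 𝒜} (f : X ⟶ Y) : Prop :=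
  ∀ i, ∃ s : (U i).obj Y ⟶ (U i).obj X, (U i).map f ≫ s ≫ (U i).map f = (U i).map f

/-- An allowable short exact sequence `0 ⟶ N ⟶ E ⟶ M ⟶ 0`. -/
structure AllowableSES (U : ι → 𝒜 ⥤ ℬ) (N M : 𝒜) where
  /-- the middle term -/
  E : 𝒜
  /-- the inclusion -/
  inc : N ⟶ E
  /-- the projection -/
  proj : E ⟶ M
  zero : inc ≫ proj = 0
  shortExact : (ShortComplex.mk inc proj zero).ShortExact
  allowable_inc : Allowable U inc
  allowable_proj : Allowable U proj

variable {U : ι → 𝒜 ⥤ ℬ}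

attribute [local simp] pullback.lift_fst pullback.lift_snd pullback.lift_fst_assoc
  pullback.lift_snd_assoc pushout.inl_desc pushout.inr_desc pushout.inl_desc_assoc
  pushout.inr_desc_assoc

lemma biprod_map_id (X Y : 𝒜) : biprod.map (𝟙 X) (𝟙 Y) = 𝟙 (X ⊞ Y) := by ext <;> simp

lemma splits_of_section {X Y : ℬ} {g : X ⟶ Y} {s : Y ⟶ X} (h : s ≫ g = 𝟙 Y) :
    ∃ s : Y ⟶ X, g ≫ s ≫ g = g := ⟨s, by rw [h, Category.comp_id]⟩

lemma splits_of_retraction {X Y : ℬ} {f : X ⟶ Y} {r : Y ⟶ X} (h : f ≫ r = 𝟙 X) :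
    ∃ s : Y ⟶ X, f ≫ s ≫ f = f := ⟨r, by rw [reassoc_of% h]⟩

lemma shortExact_of_kernel {N E M : 𝒜} (f : N ⟶ E) (g : E ⟶ M) (w : f ≫ g = 0)
    (hk : ∀ {A : 𝒜} (k : A ⟶ E), k ≫ g = 0 → ∃ l, l ≫ f = k) (hf : Mono f) (hg : Epi g) :
    (ShortComplex.mk f g w).ShortExact :=
  ShortComplex.ShortExact.mk' (ShortComplex.exact_of_f_is_kernel _
    (KernelFork.IsLimit.ofι' f w fun k hk' ↦ ⟨(hk k hk').choose, (hk k hk').choose_spec⟩)) hf hg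

lemma shortExact_of_cokernel {N E M : 𝒜} (f : N ⟶ E) (g : E ⟶ M) (w : f ≫ g = 0)
    (hc : ∀ {A : 𝒜} (k : E ⟶ A), f ≫ k = 0 → ∃ l, g ≫ l = k) (hf : Mono f) (hg : Epi g) :
    (ShortComplex.mk f g w).ShortExact :=
  ShortComplex.ShortExact.mk' (ShortComplex.exact_of_g_is_cokernel _
    (CokernelCofork.IsColimit.ofπ' g w fun k hk' ↦
      ⟨(hc k hk').choose, (hc k hk').choose_spec⟩)) hf hg

namespace AllowableSES

/-- There is a morphism of short exact sequences `S ⟶ T` which is `α` on the left ends and `β` on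
the right ends. -/
def Mor {N M N' M' : 𝒜} (S : AllowableSES U N M) (T : AllowableSES U N' M')
    (α : N ⟶ N') (β : M ⟶ M') : Prop :=
  ∃ e : S.E ⟶ T.E, S.inc ≫ e = α ≫ T.inc ∧ S.proj ≫ β = e ≫ T.proj

instance {N M : 𝒜} (S : AllowableSES U N M) : Mono S.inc := S.shortExact.mono_f

instance {N M : 𝒜} (S : AllowableSES U N M) : Epi S.proj := S.shortExact.epi_g

variable [∀ i, PreservesFiniteLimits (U i)] [∀ i, PreservesFiniteColimits (U i)]

lemma additive_of_exact (i : ι) : (U i).Additive := Functor.additive_of_preserves_binary_products _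

attribute [local instance] additive_of_exact

lemma exists_section {N M : 𝒜} (S : AllowableSES U N M) (i : ι) :
    ∃ s : (U i).obj M ⟶ (U i).obj S.E, s ≫ (U i).map S.proj = 𝟙 _ := by
  obtain ⟨s, hs⟩ := S.allowable_proj i
  refine ⟨s, ?_⟩
  rw [← cancel_epi ((U i).map S.proj), hs, Category.comp_id]

lemma exists_retraction {N M : 𝒜} (S : AllowableSES U N M) (i : ι) :
    ∃ r : (U i).obj S.E ⟶ (U i).obj N, (U i).map S.inc ≫ r = 𝟙 _ := by
  obtain ⟨r, hr⟩ := S.allowable_inc i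
  refine ⟨r, ?_⟩
  rw [← cancel_mono ((U i).map S.inc), Category.assoc, hr, Category.id_comp]

/-- An allowable short exact sequence from a kernel diagram with objectwise sections. -/
abbrev ofKernel {N E M : 𝒜} (f : N ⟶ E) (g : E ⟶ M) (w : f ≫ g = 0)
    (hk : ∀ {A : 𝒜} (k : A ⟶ E), k ≫ g = 0 → ∃ l, l ≫ f = k) (hf : Mono f) (hg : Epi g)
    (hs : ∀ i, ∃ s : (U i).obj M ⟶ (U i).obj E, s ≫ (U i).map g = 𝟙 _) :
    AllowableSES U N M where
  E := E
  inc := f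
  proj := g
  zero := w
  shortExact := shortExact_of_kernel f g w hk hf hg
  allowable_inc i := by
    obtain ⟨s, hs⟩ := hs i
    have h := (shortExact_of_kernel f g w hk hf hg).map_of_exact (U i)
    have sp := ShortComplex.Splitting.ofExactOfSection _ h.exact s hs h.mono_f
    have e : (U i).map f ≫ sp.r = 𝟙 _ := sp.f_r
    exact splits_of_retraction e
  allowable_proj i := by
    obtain ⟨s, hs⟩ := hs i
    exact ⟨s, by rw [hs, Category.comp_id]⟩

/-- An allowable short exact sequence from a cokernel diagram with objectwise retractions. -/
abbrev ofCokernel {N E M : 𝒜} (f : N ⟶ E) (g : E ⟶ M) (w : f ≫ g = 0)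
    (hc : ∀ {A : 𝒜} (k : E ⟶ A), f ≫ k = 0 → ∃ l, g ≫ l = k) (hf : Mono f) (hg : Epi g)
    (hr : ∀ i, ∃ r : (U i).obj E ⟶ (U i).obj N, (U i).map f ≫ r = 𝟙 _) :
    AllowableSES U N M where
  E := E
  inc := f
  proj := g
  zero := w
  shortExact := shortExact_of_cokernel f g w hc hf hg
  allowable_inc i := by
    obtain ⟨r, hr⟩ := hr i
    exact ⟨r, by rw [reassoc_of% hr]⟩
  allowable_proj i := by
    obtain ⟨r, hr⟩ := hr i
    have h := (shortExact_of_cokernel f g w hc hf hg).map_of_exact (U i)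
    have sp := ShortComplex.Splitting.ofExactOfRetraction _ h.exact r hr h.epi_g
    have e : sp.s ≫ (U i).map g = 𝟙 _ := sp.s_g
    exact splits_of_section e

lemma exists_lift {N M A : 𝒜} (S : AllowableSES U N M) (k : A ⟶ S.E) (hk : k ≫ S.proj = 0) :
    ∃ l, l ≫ S.inc = k :=
  ⟨S.shortExact.exact.lift k hk, S.shortExact.exact.lift_f k hk⟩

lemma exists_desc {N M A : 𝒜} (S : AllowableSES U N M) (k : S.E ⟶ A) (hk : S.inc ≫ k = 0) :
    ∃ l, S.proj ≫ l = k :=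
  ⟨S.shortExact.exact.desc k hk, S.shortExact.exact.g_desc k hk⟩

/-- The pullback of a short exact sequence along a morphism `M' ⟶ M`. -/
abbrev pull {N M M' : 𝒜} (S : AllowableSES U N M) (β : M' ⟶ M) : AllowableSES U N M' :=
  ofKernel (E := pullback S.proj β)
    (pullback.lift S.inc 0 (by rw [S.zero, zero_comp])) (pullback.snd S.proj β)
    (pullback.lift_snd _ _ _)
    (fun {A} k hk ↦ by
      obtain ⟨l, hl⟩ := S.exists_lift (k ≫ pullback.fst _ _)
        (by rw [Category.assoc, pullback.condition, reassoc_of% hk, zero_comp])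
      refine ⟨l, ?_⟩
      apply pullback.hom_ext
      · rw [Category.assoc, pullback.lift_fst, hl]
      · rw [Category.assoc, pullback.lift_snd, hk, comp_zero])
    (mono_of_mono_fac (pullback.lift_fst _ _ _))
    inferInstance
    (fun i ↦ by
      obtain ⟨s, hs⟩ := S.exists_section i
      have hp := (IsPullback.of_hasPullback S.proj β).map (U i)
      exact ⟨hp.lift ((U i).map β ≫ s) (𝟙 _) (by simp [hs]), by simp⟩)

/-- The pushout of a short exact sequence along a morphism `N ⟶ N'`. -/
abbrev push {N M N' : 𝒜} (S : AllowableSES U N M) (α : N ⟶ N') : AllowableSES U N' M :=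
  ofCokernel (E := pushout S.inc α) (pushout.inr S.inc α)
    (pushout.desc S.proj 0 (by rw [S.zero, comp_zero]))
    (pushout.inr_desc _ _ _)
    (fun {A} k hk ↦ by
      obtain ⟨l, hl⟩ := S.exists_desc (pushout.inl _ _ ≫ k)
        (by rw [pushout.condition_assoc, hk, comp_zero])
      refine ⟨l, ?_⟩
      apply pushout.hom_ext
      · rw [pushout.inl_desc_assoc, hl]
      · rw [pushout.inr_desc_assoc, hk, zero_comp])
    inferInstance
    (epi_of_epi_fac (pushout.inl_desc _ _ _))
    (fun i ↦ by
      obtain ⟨r, hr⟩ := S.exists_retraction i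
      have hp := (IsPushout.of_hasPushout S.inc α).map (U i)
      exact ⟨hp.desc (r ≫ (U i).map α) (𝟙 _) (by simp [reassoc_of% hr]), by simp⟩)

/-- The direct sum of two short exact sequences. -/
abbrev sum {N M N' M' : 𝒜} (S : AllowableSES U N M) (T : AllowableSES U N' M') :
    AllowableSES U (N ⊞ N') (M ⊞ M') :=
  ofKernel (E := S.E ⊞ T.E) (biprod.map S.inc T.inc) (biprod.map S.proj T.proj)
    (by ext <;> simp [S.zero, T.zero])
    (fun {A} k hk ↦ by
      obtain ⟨l, hl⟩ := S.exists_lift (k ≫ biprod.fst)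
        (by simpa using congr($hk ≫ biprod.fst))
      obtain ⟨m, hm⟩ := T.exists_lift (k ≫ biprod.snd)
        (by simpa using congr($hk ≫ biprod.snd))
      exact ⟨biprod.lift l m, by ext <;> simp [hl, hm]⟩)
    inferInstance inferInstance
    (fun i ↦ by
      obtain ⟨s, hs⟩ := S.exists_section i
      obtain ⟨t, ht⟩ := T.exists_section i
      refine ⟨(U i).map biprod.fst ≫ s ≫ (U i).map biprod.inl +
        (U i).map biprod.snd ≫ t ≫ (U i).map biprod.inr, ?_⟩
      simp only [Preadditive.add_comp, Category.assoc, ← Functor.map_comp, biprod.inl_map,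
        biprod.inr_map]
      simp only [Functor.map_comp, reassoc_of% hs, reassoc_of% ht]
      rw [← Functor.map_comp, ← Functor.map_comp, ← Functor.map_add, biprod.total,
        CategoryTheory.Functor.map_id])

/-- The split short exact sequence `0 ⟶ N ⟶ N ⊞ M ⟶ M ⟶ 0`. -/
abbrev split (N M : 𝒜) : AllowableSES U N M where
  E := N ⊞ M
  inc := biprod.inl
  proj := biprod.snd
  zero := by simp
  shortExact := (ShortComplex.Splitting.ofHasBinaryBiproduct N M).shortExact
  allowable_inc i := ⟨(U i).map biprod.fst, by simp [← Functor.map_comp]⟩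
  allowable_proj i := ⟨(U i).map biprod.inr, by simp [← Functor.map_comp]⟩

variable {N M N' M' N'' M'' N₁ M₁ N₁' M₁' : 𝒜}

lemma Mor.id (S : AllowableSES U N M) : Mor S S (𝟙 _) (𝟙 _) := ⟨𝟙 _, by simp, by simp⟩

lemma Mor.comp {S : AllowableSES U N M} {T : AllowableSES U N' M'} {V : AllowableSES U N'' M''}
    {α : N ⟶ N'} {β : M ⟶ M'} {α' : N' ⟶ N''} {β' : M' ⟶ M''}
    (h : Mor S T α β) (h' : Mor T V α' β') : Mor S V (α ≫ α') (β ≫ β') := by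
  obtain ⟨e, h₁, h₂⟩ := h
  obtain ⟨e', h₁', h₂'⟩ := h'
  exact ⟨e ≫ e', by rw [reassoc_of% h₁, h₁', Category.assoc],
    by rw [reassoc_of% h₂, h₂', Category.assoc]⟩

lemma mor_pull (S : AllowableSES U N M) (β : M' ⟶ M) : Mor (S.pull β) S (𝟙 _) β :=
  ⟨pullback.fst _ _, by simp, by simp [pullback.condition]⟩

lemma mor_push (S : AllowableSES U N M) (α : N ⟶ N') : Mor S (S.push α) α (𝟙 _) :=
  ⟨pushout.inl _ _, by simp [pushout.condition], by simp⟩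

lemma Mor.pull {S : AllowableSES U N M} {T : AllowableSES U N' M} {α : N ⟶ N'}
    (h : Mor S T α (𝟙 _)) (β : M' ⟶ M) : Mor (S.pull β) (T.pull β) α (𝟙 _) := by
  obtain ⟨e, h₁, h₂⟩ := h
  simp only [Category.comp_id] at h₂
  exact ⟨pullback.lift (pullback.fst _ _ ≫ e) (pullback.snd _ _)
    (by rw [Category.assoc, ← h₂, pullback.condition]),
    by dsimp [AllowableSES.pull, ofKernel]; apply pullback.hom_ext <;> simp [h₁],
    by simp [AllowableSES.pull, ofKernel]⟩

lemma Mor.push {S : AllowableSES U N M} {T : AllowableSES U N M'} {β : M ⟶ M'}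
    (h : Mor S T (𝟙 _) β) (α : N ⟶ N') : Mor (S.push α) (T.push α) (𝟙 _) β := by
  obtain ⟨e, h₁, h₂⟩ := h
  simp only [Category.id_comp] at h₁
  exact ⟨pushout.desc (e ≫ pushout.inl _ _) (pushout.inr _ _)
    (by rw [reassoc_of% h₁, pushout.condition]),
    by simp [AllowableSES.push, ofCokernel],
    by dsimp [AllowableSES.push, ofCokernel]; apply pushout.hom_ext <;> simp [h₂]⟩

lemma Mor.push_pull {S : AllowableSES U N M} {T : AllowableSES U N' M'} {α : N ⟶ N'} {β : M ⟶ M'}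
    (h : Mor S T α β) : Mor (S.push α) (T.pull β) (𝟙 _) (𝟙 _) := by
  obtain ⟨e, h₁, h₂⟩ := h
  refine ⟨pushout.desc (pullback.lift e S.proj h₂.symm) (pullback.lift T.inc 0 (by simp [T.zero]))
    ?_, ?_, ?_⟩
  · apply pullback.hom_ext <;> simp [h₁, S.zero]
  · apply pullback.hom_ext <;> simp [AllowableSES.push, AllowableSES.pull, ofCokernel, ofKernel]
  · dsimp [AllowableSES.push, AllowableSES.pull, ofCokernel, ofKernel]
    apply pushout.hom_ext <;> simp

lemma Mor.sum {S : AllowableSES U N M} {T : AllowableSES U N' M'}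
    {S₁ : AllowableSES U N₁ M₁} {T₁ : AllowableSES U N₁' M₁'} {α : N ⟶ N'} {β : M ⟶ M'}
    {α₁ : N₁ ⟶ N₁'} {β₁ : M₁ ⟶ M₁'} (h : Mor S T α β) (h' : Mor S₁ T₁ α₁ β₁) :
    Mor (S.sum S₁) (T.sum T₁) (biprod.map α α₁) (biprod.map β β₁) := by
  obtain ⟨e, h₁, h₂⟩ := h
  obtain ⟨e', h₁', h₂'⟩ := h'
  refine ⟨biprod.map e e', ?_, ?_⟩ <;> dsimp [AllowableSES.sum, ofKernel] <;> ext <;>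
    simp [h₁, h₂, h₁', h₂']

lemma mor_diag (S : AllowableSES U N M) :
    Mor S (S.sum S) (biprod.lift (𝟙 _) (𝟙 _)) (biprod.lift (𝟙 _) (𝟙 _)) := by
  refine ⟨biprod.lift (𝟙 _) (𝟙 _), ?_, ?_⟩ <;> dsimp [AllowableSES.sum, ofKernel] <;> ext <;> simp

lemma mor_fst (S : AllowableSES U N M) (T : AllowableSES U N' M') :
    Mor (S.sum T) S biprod.fst biprod.fst :=
  ⟨biprod.fst, by simp [AllowableSES.sum, ofKernel], by simp [AllowableSES.sum, ofKernel]⟩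

lemma mor_braid (S : AllowableSES U N M) (T : AllowableSES U N' M') :
    Mor (S.sum T) (T.sum S) (biprod.lift biprod.snd biprod.fst)
      (biprod.lift biprod.snd biprod.fst) := by
  refine ⟨biprod.lift biprod.snd biprod.fst, ?_, ?_⟩ <;> dsimp [AllowableSES.sum, ofKernel] <;>
    ext <;> simp

lemma mor_assoc (S : AllowableSES U N M) (T : AllowableSES U N' M') (V : AllowableSES U N'' M'') :
    Mor ((S.sum T).sum V) (S.sum (T.sum V)) (biprod.associator _ _ _).hom
      (biprod.associator _ _ _).hom := by
  refine ⟨(biprod.associator _ _ _).hom, ?_, ?_⟩ <;> dsimp [AllowableSES.sum, ofKernel] <;>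
    ext <;> simp

lemma mor_split (S : AllowableSES U N M) (β : M ⟶ M') : Mor S (split N' M') 0 β :=
  ⟨S.proj ≫ β ≫ biprod.inr, by simp [reassoc_of% S.zero], by simp [split]⟩

end AllowableSES

/-- Allowable `n`-fold extensions of `M` by `N`.
* A `0`-fold extension is a morphism `M ⟶ N`.
* A `1`-fold extension is an allowable short exact sequence `0 ⟶ N ⟶ E ⟶ M ⟶ 0`.
* An `(n + 2)`-fold extension `0 ⟶ N ⟶ E_{n+1} ⟶ ⋯ ⟶ E_0 ⟶ M ⟶ 0` is given by the kernel `K` of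
  `E_0 ⟶ M`, by the allowable short exact sequence `0 ⟶ K ⟶ E_0 ⟶ M ⟶ 0` and by the
  `(n + 1)`-fold extension `0 ⟶ N ⟶ E_{n+1} ⟶ ⋯ ⟶ E_1 ⟶ K ⟶ 0` of `K` by `N`.

An exact sequence has allowable maps if and only if the short exact sequences into which it
decomposes have allowable maps, so this describes the exact sequences with allowable maps. -/
inductive Extension (U : ι → 𝒜 ⥤ ℬ) (N : 𝒜) : ℕ → 𝒜 → Type (max u v)
  | hom {M : 𝒜} (f : M ⟶ N) : Extension U N 0 M
  | short {M : 𝒜} (S : AllowableSES U N M) : Extension U N 1 M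
  | cons {n : ℕ} {M K : 𝒜} (S : AllowableSES U K M) (E : Extension U N (n + 1) K) :
      Extension U N (n + 2) M

namespace Extension

/-- There is a morphism `E ⟶ F` of `n`-fold extensions, i.e. a morphism of exact sequences, which
is `α` on the left ends and `β` on the right ends.  For `n = 0` this means that the square formed
by `E`, `F`, `α` and `β` commutes. -/
def Mor {N N' : 𝒜} (α : N ⟶ N') : ∀ {n : ℕ} {M M' : 𝒜}, Extension U N n M →
    Extension U N' n M' → (M ⟶ M') → Prop
  | _, _, _, .hom f, .hom g, β => f ≫ α = β ≫ g
  | _, _, _, .short S, .short T, β => AllowableSES.Mor S T α β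
  | _, _, _, .cons (K := K) S E, .cons (K := K') T F, β =>
      ∃ κ : K ⟶ K', AllowableSES.Mor S T κ β ∧ Mor α E F κ

variable [∀ i, PreservesFiniteLimits (U i)] [∀ i, PreservesFiniteColimits (U i)]

/-- The pullback of an extension along a morphism `M' ⟶ M`. -/
def pull {N M' : 𝒜} : ∀ {n : ℕ} {M : 𝒜}, Extension U N n M → (M' ⟶ M) → Extension U N n M'
  | _, _, .hom f, β => .hom (β ≫ f)
  | _, _, .short S, β => .short (S.pull β)
  | _, _, .cons S E, β => .cons (S.pull β) E

/-- The pushout of an extension along a morphism `N ⟶ N'`. -/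
def push {N N' : 𝒜} (α : N ⟶ N') : ∀ {n : ℕ} {M : 𝒜}, Extension U N n M → Extension U N' n M
  | _, _, .hom f => .hom (f ≫ α)
  | _, _, .short S => .short (S.push α)
  | _, _, .cons S E => .cons S (push α E)

/-- The direct sum of two extensions. -/
def sum {N N' : 𝒜} : ∀ {n : ℕ} {M M' : 𝒜}, Extension U N n M → Extension U N' n M' →
    Extension U (N ⊞ N') n (M ⊞ M')
  | _, _, _, .hom f, .hom g => .hom (biprod.map f g)
  | _, _, _, .short S, .short T => .short (S.sum T)
  | _, _, _, .cons S E, .cons T F => .cons (S.sum T) (sum E F)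

/-- The trivial `n`-fold extension: the zero morphism for `n = 0`, the split extension for `n = 1`,
and `0 ⟶ N ⟶ N ⟶ 0 ⟶ ⋯ ⟶ 0 ⟶ M ⟶ M ⟶ 0` for larger `n` (up to isomorphism). -/
def trivial (N : 𝒜) : ∀ (n : ℕ) (M : 𝒜), Extension U N n M
  | 0, _ => .hom 0
  | 1, M => .short (.split N M)
  | n + 2, M => .cons (.split 0 M) (trivial N (n + 1) 0)

variable {N N' N'' N₁ N₁' : 𝒜} {n : ℕ} {M M' M'' M₁ M₁' : 𝒜}

lemma Mor.id (E : Extension U N n M) : Mor (𝟙 _) E E (𝟙 _) := by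
  induction E with
  | hom f => simp [Mor]
  | short S => exact AllowableSES.Mor.id S
  | cons S E ih => exact ⟨𝟙 _, AllowableSES.Mor.id S, ih⟩

lemma Mor.comp {E : Extension U N n M} {F : Extension U N' n M'} {G : Extension U N'' n M''}
    {α : N ⟶ N'} {β : M ⟶ M'} {α' : N' ⟶ N''} {β' : M' ⟶ M''}
    (h : Mor α E F β) (h' : Mor α' F G β') : Mor (α ≫ α') E G (β ≫ β') := by
  induction E generalizing M' M'' with
  | hom f =>
    cases F; cases G
    simp only [Mor] at h h' ⊢
    rw [reassoc_of% h, h', Category.assoc]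
  | short S => cases F; cases G; exact AllowableSES.Mor.comp h h'
  | cons S E ih =>
    cases F; cases G
    obtain ⟨κ, h₁, h₂⟩ := h
    obtain ⟨κ', h₁', h₂'⟩ := h'
    exact ⟨κ ≫ κ', h₁.comp h₁', ih h₂ h₂'⟩

lemma mor_pull (E : Extension U N n M) (β : M' ⟶ M) : Mor (𝟙 _) (E.pull β) E β := by
  cases E with
  | hom f => simp [Mor, pull]
  | short S => exact S.mor_pull β
  | cons S E => exact ⟨𝟙 _, S.mor_pull β, Mor.id E⟩

lemma mor_push (E : Extension U N n M) (α : N ⟶ N') : Mor α E (E.push α) (𝟙 _) := by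
  induction E with
  | hom f => simp [Mor, push]
  | short S => exact S.mor_push α
  | cons S E ih => exact ⟨𝟙 _, .id S, ih⟩

lemma Mor.pull {E F : Extension U N n M} (h : Mor (𝟙 _) E F (𝟙 _)) (β : M' ⟶ M) :
    Mor (𝟙 _) (E.pull β) (F.pull β) (𝟙 _) := by
  cases E with
  | hom f =>
    cases F
    simp only [Mor, Category.comp_id, Category.id_comp] at h
    subst h
    exact Mor.id _
  | short S => cases F; exact AllowableSES.Mor.pull h β
  | cons S E =>
    cases F with
    | cons T F =>
    obtain ⟨κ, h₁, h₂⟩ := h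
    exact ⟨κ, h₁.pull β, h₂⟩

lemma Mor.push {E : Extension U N n M} {F : Extension U N n M'} {β : M ⟶ M'}
    (h : Mor (𝟙 _) E F β) (α : N ⟶ N') : Mor (𝟙 _) (E.push α) (F.push α) β := by
  induction E generalizing M' with
  | hom f =>
    cases F
    simp only [Mor, Category.comp_id] at h
    simp [Mor, Extension.push, h]
  | short S => cases F; exact AllowableSES.Mor.push h α
  | cons S E ih =>
    cases F with
    | cons T F =>
    obtain ⟨κ, h₁, h₂⟩ := h
    exact ⟨κ, h₁, ih h₂⟩

lemma Mor.sum {E : Extension U N n M} {F : Extension U N' n M'} {E₁ : Extension U N₁ n M₁}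
    {F₁ : Extension U N₁' n M₁'} {α : N ⟶ N'} {β : M ⟶ M'} {α₁ : N₁ ⟶ N₁'} {β₁ : M₁ ⟶ M₁'}
    (h : Mor α E F β) (h' : Mor α₁ E₁ F₁ β₁) :
    Mor (biprod.map α α₁) (E.sum E₁) (F.sum F₁) (biprod.map β β₁) := by
  induction E generalizing M' M₁ M₁' with
  | hom f =>
    cases F; cases E₁; cases F₁
    simp only [Mor] at h h'
    simp only [Mor, Extension.sum]
    ext <;> simp [h, h']
  | short S => cases F; cases E₁; cases F₁; exact AllowableSES.Mor.sum h h'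
  | cons S E ih =>
    cases F; cases E₁; cases F₁
    obtain ⟨κ, h₁, h₂⟩ := h
    obtain ⟨κ', h₁', h₂'⟩ := h'
    exact ⟨_, h₁.sum h₁', ih h₂ h₂'⟩

lemma mor_diag (E : Extension U N n M) :
    Mor (biprod.lift (𝟙 _) (𝟙 _)) E (E.sum E) (biprod.lift (𝟙 _) (𝟙 _)) := by
  induction E with
  | hom f => simp only [Mor, Extension.sum]; ext <;> simp
  | short S => exact S.mor_diag
  | cons S E ih => exact ⟨_, S.mor_diag, ih⟩

lemma mor_fst (E : Extension U N n M) (F : Extension U N' n M') :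
    Mor biprod.fst (E.sum F) E biprod.fst := by
  induction E generalizing M' with
  | hom f => cases F; simp [Mor, Extension.sum]
  | short S => cases F; exact S.mor_fst _
  | cons S E ih => cases F; exact ⟨_, S.mor_fst _, ih _⟩

lemma mor_braid (E : Extension U N n M) (F : Extension U N' n M') :
    Mor (biprod.lift biprod.snd biprod.fst) (E.sum F) (F.sum E)
      (biprod.lift biprod.snd biprod.fst) := by
  induction E generalizing M' with
  | hom f => cases F; simp only [Mor, Extension.sum]; ext <;> simp
  | short S => cases F; exact S.mor_braid _
  | cons S E ih => cases F; exact ⟨_, S.mor_braid _, ih _⟩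

lemma mor_assoc (E : Extension U N n M) (F : Extension U N' n M') (G : Extension U N'' n M'') :
    Mor (biprod.associator _ _ _).hom ((E.sum F).sum G) (E.sum (F.sum G))
      (biprod.associator _ _ _).hom := by
  induction E generalizing M' M'' with
  | hom f => cases F; cases G; simp only [Mor, Extension.sum]; ext <;> simp
  | short S => cases F; cases G; exact S.mor_assoc _ _
  | cons S E ih => cases F; cases G; exact ⟨_, S.mor_assoc _ _, ih _ _⟩

lemma mor_trivial (E : Extension U N n M) (β : M ⟶ M') :
    Mor 0 E (trivial N' n M') β := by
  induction E generalizing M' with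
  | hom f => simp [Mor, trivial]
  | short S => exact S.mor_split β
  | cons S E ih => exact ⟨0, S.mor_split β, ih 0⟩

/-- Two extensions of `M` by `N` are elementarily equivalent when there is a morphism from one to
the other which is the identity on both ends. -/
def Step (E F : Extension U N n M) : Prop := Mor (𝟙 N) E F (𝟙 M)

lemma Mor.push_pull {E : Extension U N n M} {F : Extension U N' n M'} {α : N ⟶ N'} {β : M ⟶ M'}
    (h : Mor α E F β) : Relation.EqvGen Step (E.push α) (F.pull β) := by
  induction E generalizing M' with
  | hom f =>
    cases F
    simp only [Mor] at h
    simp only [Extension.push, Extension.pull, h]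
    exact .refl _
  | short S => cases F; exact .rel _ _ (AllowableSES.Mor.push_pull h)
  | @cons n M K S E ih =>
    cases F with
    | @cons _ _ K' T F =>
    obtain ⟨κ, h₁, h₂⟩ := h
    have step₁ : Relation.EqvGen Step (cons S (E.push α)) (cons S (F.pull κ)) := by
      generalize E.push α = X at ih
      have := ih h₂
      generalize F.pull κ = Y at this
      clear ih h₂
      induction this with
      | rel X Y h => exact .rel _ _ ⟨𝟙 _, .id S, h⟩
      | refl X => exact .refl _
      | symm X Y _ ih => exact .symm _ _ ih
      | trans X Y Z _ _ ih ih' => exact .trans _ _ _ ih ih'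
    have step₂ : Relation.EqvGen Step (cons S (F.pull κ)) (cons (S.push κ) F) :=
      .rel _ _ ⟨κ, S.mor_push κ, F.mor_pull κ⟩
    have step₃ : Relation.EqvGen Step (cons (S.push κ) F) (cons (T.pull β) F) :=
      .rel _ _ ⟨𝟙 _, h₁.push_pull, .id F⟩
    exact .trans _ _ _ step₁ (.trans _ _ _ step₂ step₃)

end Extension

/-- The relative Yoneda cohomology `Ext^n(M, N)`: allowable `n`-fold extensions of `M` by `N`
modulo the equivalence relation generated by the morphisms of extensions which are the identity on
both ends. -/
def Ext (U : ι → 𝒜 ⥤ ℬ) (n : ℕ) (M N : 𝒜) : Type (max u v) :=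
  Quot (Extension.Step : Extension U N n M → Extension U N n M → Prop)

namespace Ext

variable {N N' N'' N₁ N₁' : 𝒜} {n : ℕ} {M M' M'' M₁ M₁' : 𝒜}

/-- The class of an extension. -/
def mk (E : Extension U N n M) : Ext U n M N := Quot.mk _ E

lemma mk_surjective (ξ : Ext U n M N) : ∃ E, mk E = ξ := Quot.exists_rep ξ

variable [∀ i, PreservesFiniteLimits (U i)] [∀ i, PreservesFiniteColimits (U i)]

/-- The map `Ext^n(M, N) → Ext^n(M', N)` induced by `β : M' ⟶ M`, through pullbacks. -/
def pull (β : M' ⟶ M) : Ext U n M N → Ext U n M' N :=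
  Quot.map (fun E ↦ E.pull β) fun _ _ h ↦ Extension.Mor.pull h β

/-- The map `Ext^n(M, N) → Ext^n(M, N')` induced by `α : N ⟶ N'`, through pushouts. -/
def push (α : N ⟶ N') : Ext U n M N → Ext U n M N' :=
  Quot.map (fun E ↦ E.push α) fun _ _ h ↦ Extension.Mor.push h α

/-- The direct sum map `Ext^n(M, N) × Ext^n(M', N') → Ext^n(M ⊞ M', N ⊞ N')`. -/
def sum : Ext U n M N → Ext U n M' N' → Ext U n (M ⊞ M') (N ⊞ N') :=
  Quot.map₂ (fun E F ↦ E.sum F)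
    (fun E F F' h ↦ by simpa only [Extension.Step, biprod_map_id] using (Extension.Mor.id E).sum h)
    (fun E E' F h ↦ by simpa only [Extension.Step, biprod_map_id] using Extension.Mor.sum h (Extension.Mor.id F))

/-- The Baer sum. -/
instance : Add (Ext U n M N) where
  add ξ η := push (biprod.desc (𝟙 N) (𝟙 N)) (pull (biprod.lift (𝟙 M) (𝟙 M)) (sum ξ η))

/-- The zero element is the class of the trivial extension. -/
instance : Zero (Ext U n M N) where
  zero := mk (Extension.trivial N n M)

instance : Neg (Ext U n M N) where
  neg ξ := push (-𝟙 N) ξ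

lemma add_def (ξ η : Ext U n M N) :
    ξ + η = push (biprod.desc (𝟙 N) (𝟙 N)) (pull (biprod.lift (𝟙 M) (𝟙 M)) (sum ξ η)) := rfl

lemma zero_def : (0 : Ext U n M N) = mk (Extension.trivial N n M) := rfl

lemma neg_def (ξ : Ext U n M N) : -ξ = push (-𝟙 N) ξ := rfl

lemma mk_eq {E F : Extension U N n M} (h : Extension.Mor (𝟙 _) E F (𝟙 _)) : mk E = mk F :=
  Quot.sound h

lemma push_mk_eq {E : Extension U N n M} {F : Extension U N' n M'} {α : N ⟶ N'} {β : M ⟶ M'}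
    (h : Extension.Mor α E F β) : push α (mk E) = pull β (mk F) :=
  Quot.eqvGen_sound h.push_pull

@[simp] lemma pull_id (ξ : Ext U n M N) : pull (𝟙 _) ξ = ξ := by
  obtain ⟨E, rfl⟩ := mk_surjective ξ
  exact mk_eq (E.mor_pull _)

@[simp] lemma push_id (ξ : Ext U n M N) : push (𝟙 _) ξ = ξ := by
  obtain ⟨E, rfl⟩ := mk_surjective ξ
  exact (mk_eq (E.mor_push _)).symm

lemma pull_pull (β : M' ⟶ M) (β' : M'' ⟶ M') (ξ : Ext U n M N) :
    pull β' (pull β ξ) = pull (β' ≫ β) ξ := by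
  obtain ⟨E, rfl⟩ := mk_surjective ξ
  have := push_mk_eq (((E.pull β).mor_pull β').comp (E.mor_pull β))
  rw [Category.comp_id, push_id] at this
  exact this

lemma push_push (α : N ⟶ N') (α' : N' ⟶ N'') (ξ : Ext U n M N) :
    push α' (push α ξ) = push (α ≫ α') ξ := by
  obtain ⟨E, rfl⟩ := mk_surjective ξ
  have := push_mk_eq ((E.mor_push α).comp ((E.push α).mor_push α'))
  rw [Category.comp_id, pull_id] at this
  exact this.symm

lemma push_pull (α : N ⟶ N') (β : M' ⟶ M) (ξ : Ext U n M N) :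
    push α (pull β ξ) = pull β (push α ξ) := by
  obtain ⟨E, rfl⟩ := mk_surjective ξ
  have := push_mk_eq ((E.mor_pull β).comp (E.mor_push α))
  rw [Category.comp_id, Category.id_comp] at this
  exact this

lemma sum_push (α : N ⟶ N') (α₁ : N₁ ⟶ N₁') (ξ : Ext U n M N) (η : Ext U n M₁ N₁) :
    sum (push α ξ) (push α₁ η) = push (biprod.map α α₁) (sum ξ η) := by
  obtain ⟨E, rfl⟩ := mk_surjective ξ
  obtain ⟨F, rfl⟩ := mk_surjective η
  have := push_mk_eq ((E.mor_push α).sum (F.mor_push α₁))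
  rw [biprod_map_id, pull_id] at this
  exact this.symm

lemma sum_pull (β : M' ⟶ M) (β₁ : M₁' ⟶ M₁) (ξ : Ext U n M N) (η : Ext U n M₁ N₁) :
    sum (pull β ξ) (pull β₁ η) = pull (biprod.map β β₁) (sum ξ η) := by
  obtain ⟨E, rfl⟩ := mk_surjective ξ
  obtain ⟨F, rfl⟩ := mk_surjective η
  have := push_mk_eq ((E.mor_pull β).sum (F.mor_pull β₁))
  rw [biprod_map_id, push_id] at this
  exact this

lemma push_zero (ξ : Ext U n M N) : push (0 : N ⟶ N') ξ = 0 := by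
  obtain ⟨E, rfl⟩ := mk_surjective ξ
  have := push_mk_eq (E.mor_trivial (N' := N') (𝟙 M))
  rwa [pull_id] at this

lemma push_add (α : N ⟶ N') (ξ η : Ext U n M N) : push α (ξ + η) = push α ξ + push α η := by
  rw [add_def, add_def, sum_push, ← push_pull, push_push, push_push]
  congr 1
  ext <;> simp

lemma add_push (α α' : N ⟶ N') (ξ : Ext U n M N) : push (α + α') ξ = push α ξ + push α' ξ := by
  obtain ⟨E, rfl⟩ := mk_surjective ξ
  rw [add_def, sum_push, ← push_pull, show sum (mk E) (mk E) = mk (E.sum E) from rfl,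
    ← push_mk_eq E.mor_diag, push_push, push_push]
  congr 1
  rw [show biprod.map α α' ≫ biprod.desc (𝟙 N') (𝟙 N') = biprod.desc α α' by ext <;> simp,
    biprod.lift_desc, Category.id_comp, Category.id_comp]

lemma pull_add (β : M' ⟶ M) (ξ η : Ext U n M N) : pull β (ξ + η) = pull β ξ + pull β η := by
  rw [add_def, add_def, sum_pull, ← push_pull, pull_pull, pull_pull]
  congr 2
  ext <;> simp

protected lemma add_comm (ξ η : Ext U n M N) : ξ + η = η + ξ := by
  rw [add_def, add_def]
  obtain ⟨E, rfl⟩ := mk_surjective ξ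
  obtain ⟨F, rfl⟩ := mk_surjective η
  have h₁ : biprod.desc (𝟙 N) (𝟙 N) = biprod.lift biprod.snd biprod.fst ≫
      biprod.desc (𝟙 N) (𝟙 N) := by ext <;> simp
  have h₂ : biprod.lift (𝟙 M) (𝟙 M) ≫ biprod.lift biprod.snd biprod.fst =
      biprod.lift (𝟙 M) (𝟙 M) := by ext <;> simp
  rw [h₁, ← push_push, push_pull, show sum (mk E) (mk F) = mk (E.sum F) from rfl,
    push_mk_eq (E.mor_braid F), pull_pull, h₂, ← h₁]
  rfl

protected lemma add_zero (ξ : Ext U n M N) : ξ + 0 = ξ := by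
  obtain ⟨E, rfl⟩ := mk_surjective ξ
  have h : sum (mk E) (0 : Ext U n M N) = push (biprod.map (𝟙 _) 0) (mk (E.sum E)) := by
    rw [← push_zero (mk E) (N' := N)]
    nth_rewrite 1 [← push_id (mk E)]
    rw [sum_push]
    rfl
  rw [add_def, h, ← push_pull, push_push,
    show biprod.map (𝟙 N) (0 : N ⟶ N) ≫ biprod.desc (𝟙 N) (𝟙 N) = biprod.fst by ext <;> simp,
    push_pull, push_mk_eq (E.mor_fst E), pull_pull, biprod.lift_fst, pull_id]

protected lemma add_assoc (ξ η ζ : Ext U n M N) : ξ + η + ζ = ξ + (η + ζ) := by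
  obtain ⟨E, rfl⟩ := mk_surjective ξ
  obtain ⟨F, rfl⟩ := mk_surjective η
  obtain ⟨G, rfl⟩ := mk_surjective ζ
  have h₁ : mk E + mk F + mk G = push (biprod.desc (biprod.desc (𝟙 N) (𝟙 N)) (𝟙 N))
      (pull (biprod.lift (biprod.lift (𝟙 M) (𝟙 M)) (𝟙 M)) (mk ((E.sum F).sum G))) := by
    rw [add_def, add_def]
    nth_rewrite 1 [← push_id (mk G), ← pull_id (mk G)]
    rw [sum_push, sum_pull, ← push_pull, push_push, pull_pull]
    congr 2
    · ext <;> simp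
    · ext <;> simp
  have h₂ : mk E + (mk F + mk G) = push (biprod.desc (𝟙 N) (biprod.desc (𝟙 N) (𝟙 N)))
      (pull (biprod.lift (𝟙 M) (biprod.lift (𝟙 M) (𝟙 M))) (mk (E.sum (F.sum G)))) := by
    rw [add_def, add_def]
    nth_rewrite 1 [← push_id (mk E), ← pull_id (mk E)]
    rw [sum_push, sum_pull, ← push_pull, push_push, pull_pull]
    congr 2
    · ext <;> simp
    · ext <;> simp
  have h₃ : biprod.lift (𝟙 M) (biprod.lift (𝟙 M) (𝟙 M)) =
      biprod.lift (biprod.lift (𝟙 M) (𝟙 M)) (𝟙 M) ≫ (biprod.associator M M M).hom := by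
    ext <;> simp
  rw [h₁, h₂, h₃, ← pull_pull, ← push_mk_eq (E.mor_assoc F G), ← push_pull, push_push]
  congr 1
  ext <;> simp

protected lemma neg_add_cancel (ξ : Ext U n M N) : -ξ + ξ = 0 := by
  have h := add_push (-𝟙 N) (𝟙 N) ξ
  rw [neg_add_cancel, push_zero, push_id] at h
  rw [neg_def, ← h]

/-- Relative Yoneda cohomology is an abelian group under the Baer sum. -/
instance : AddCommGroup (Ext U n M N) where
  add_assoc := Ext.add_assoc
  zero_add ξ := by rw [Ext.add_comm, Ext.add_zero]
  add_zero := Ext.add_zero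
  neg_add_cancel := Ext.neg_add_cancel
  add_comm := Ext.add_comm
  nsmul := nsmulRec
  zsmul := zsmulRec

/-- When `𝒜` is a `k`-linear category, `k` acts on `Ext^n(M, N)` through its action on `N`. -/
instance {k : Type*} [CommRing k] [Linear k 𝒜] : Module k (Ext U n M N) where
  smul c ξ := push (c • 𝟙 N) ξ
  one_smul ξ := by
    change push ((1 : k) • 𝟙 N) ξ = ξ
    rw [one_smul, push_id]
  mul_smul c d ξ := by
    change push ((c * d) • 𝟙 N) ξ = push (c • 𝟙 N) (push (d • 𝟙 N) ξ)
    rw [push_push, Linear.smul_comp, Category.id_comp, smul_smul, mul_comm d c]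
  smul_zero c := by
    change push (c • 𝟙 N) (0 : Ext U n M N) = 0
    rw [← push_zero (0 : Ext U n M N) (N' := N), push_push, zero_comp, push_zero]
  smul_add c ξ η := push_add _ ξ η
  add_smul c d ξ := by
    change push ((c + d) • 𝟙 N) ξ = push (c • 𝟙 N) ξ + push (d • 𝟙 N) ξ
    rw [add_smul, add_push]
  zero_smul ξ := by
    change push ((0 : k) • 𝟙 N) ξ = 0
    rw [zero_smul, push_zero]

end Ext

section Functoriality

variable {𝒜' : Type u₁} [Category.{v₁} 𝒜'] [Abelian 𝒜'] {ι' : Type w'}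
  {U : ι → 𝒜 ⥤ ℬ} {U' : ι' → 𝒜' ⥤ ℬ} (F : 𝒜 ⥤ 𝒜')
  [PreservesFiniteLimits F] [PreservesFiniteColimits F]
  (hF : ∀ ⦃X Y : 𝒜⦄ (f : X ⟶ Y), Allowable U f → Allowable U' (F.map f))

lemma preservesZeroMorphisms_of_exact : F.PreservesZeroMorphisms :=
  have : F.Additive := Functor.additive_of_preserves_binary_products F
  inferInstance

attribute [local instance] preservesZeroMorphisms_of_exact

/-- The image of an allowable short exact sequence under an exact functor which preserves
allowable morphisms. -/
def AllowableSES.map {N M : 𝒜} (S : AllowableSES U N M) :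
    AllowableSES U' (F.obj N) (F.obj M) where
  E := F.obj S.E
  inc := F.map S.inc
  proj := F.map S.proj
  zero := by rw [← F.map_comp, S.zero, F.map_zero]
  shortExact := S.shortExact.map_of_exact F
  allowable_inc := hF _ S.allowable_inc
  allowable_proj := hF _ S.allowable_proj

/-- The image of an allowable extension under an exact functor which preserves allowable
morphisms. -/
def Extension.map {N : 𝒜} : ∀ {n : ℕ} {M : 𝒜}, Extension U N n M →
    Extension U' (F.obj N) n (F.obj M)
  | _, _, .hom f => .hom (F.map f)
  | _, _, .short S => .short (S.map F hF)
  | _, _, .cons S E => .cons (S.map F hF) (E.map)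

lemma AllowableSES.Mor.map {N M N' M' : 𝒜} {S : AllowableSES U N M} {T : AllowableSES U N' M'}
    {α : N ⟶ N'} {β : M ⟶ M'} (h : AllowableSES.Mor S T α β) :
    AllowableSES.Mor (S.map F hF) (T.map F hF) (F.map α) (F.map β) := by
  obtain ⟨e, h₁, h₂⟩ := h
  refine ⟨F.map e, ?_, ?_⟩
  · change F.map S.inc ≫ F.map e = F.map α ≫ F.map T.inc
    rw [← F.map_comp, h₁, F.map_comp]
  · change F.map S.proj ≫ F.map β = F.map e ≫ F.map T.proj
    rw [← F.map_comp, h₂, F.map_comp]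

lemma Extension.Mor.map {N N' : 𝒜} {n : ℕ} {M M' : 𝒜} {E : Extension U N n M}
    {E' : Extension U N' n M'} {α : N ⟶ N'} {β : M ⟶ M'} (h : Extension.Mor α E E' β) :
    Extension.Mor (F.map α) (E.map F hF) (E'.map F hF) (F.map β) := by
  induction E generalizing M' with
  | hom f =>
    cases E'
    simp only [Extension.Mor] at h
    simp only [Extension.Mor, Extension.map, ← F.map_comp, h]
  | short S => cases E'; exact AllowableSES.Mor.map F hF h
  | cons S E ih =>
    cases E'
    obtain ⟨κ, h₁, h₂⟩ := h
    exact ⟨F.map κ, h₁.map F hF, ih h₂⟩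

/-- The map `[E] ↦ [F(E)]` on relative Yoneda cohomology induced by an exact functor `F` which
preserves allowable morphisms. -/
def Ext.map {n : ℕ} {M N : 𝒜} : Ext U n M N → Ext U' n (F.obj M) (F.obj N) :=
  Quot.map (fun E ↦ E.map F hF) fun E E' h ↦ by
    have := Extension.Mor.map F hF h
    rwa [F.map_id, F.map_id] at this

end Functoriality

end Generic

end RelYoneda

namespace Diagram

universe u

/-- The objects of the subdivision of a category `C` are the simplices of `C`, that is, the
functors `[p] ⥤ C`, where `[p]` is the linearly ordered set `{0 < ⋯ < p}`. -/
structure Subdivision (C : Type u) [Category.{u} C] : Type u where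
  /-- the dimension of the simplex -/
  dim : ℕ
  /-- the simplex -/
  simplex : ComposableArrows C dim

section Subdivision

variable {C : Type u} [Category.{u} C]

/-- The condition on `v : τ(0) ⟶ σ(0)` to define a morphism `[τ, σ, v]` of the subdivision: there
is a strictly monotone map `f : [q] → [p]` such that `σ = τ ∘ f` and `v` is `τ(0 → f 0)`. -/
def IsFace {p q : ℕ} (τ : ComposableArrows C p) (σ : ComposableArrows C q)
    (v : τ.obj 0 ⟶ σ.obj 0) : Prop :=
  ∃ (f : Fin (q + 1) → Fin (p + 1)) (hf : StrictMono f) (h : hf.monotone.functor ⋙ τ = σ),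
    v = τ.map (homOfLE (Fin.zero_le (f 0))) ≫ eqToHom (Functor.congr_obj h 0)

lemma IsFace.id {p : ℕ} (τ : ComposableArrows C p) : IsFace τ τ (𝟙 _) :=
  ⟨_, strictMono_id, rfl, by simp⟩

lemma IsFace.comp {p q r : ℕ} {τ : ComposableArrows C p} {σ : ComposableArrows C q}
    {ω : ComposableArrows C r} {v : τ.obj 0 ⟶ σ.obj 0} {w : σ.obj 0 ⟶ ω.obj 0}
    (hv : IsFace τ σ v) (hw : IsFace σ ω w) : IsFace τ ω (v ≫ w) := by
  obtain ⟨f, hf, rfl, rfl⟩ := hv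
  obtain ⟨g, hg, rfl, rfl⟩ := hw
  refine ⟨f ∘ g, hf.comp hg, rfl, ?_⟩
  change (τ.map _ ≫ 𝟙 _) ≫ (τ.map _ ≫ 𝟙 _) = τ.map _ ≫ 𝟙 _
  rw [Category.comp_id, Category.comp_id, Category.comp_id]
  exact (τ.map_comp _ _).symm

/-- The subdivision of a category.  The morphisms `τ ⟶ σ` are the triples `[τ, σ, v]`, composed by
composing the third entries. -/
instance : Category.{u} (Subdivision C) where
  Hom τ σ := { v : τ.simplex.obj 0 ⟶ σ.simplex.obj 0 // IsFace τ.simplex σ.simplex v }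
  id τ := ⟨𝟙 _, IsFace.id τ.simplex⟩
  comp v w := ⟨v.1 ≫ w.1, v.2.comp w.2⟩

variable (C) in
/-- The functor `d` from the subdivision of `C` to `C`, with `d τ = τ(0)` and `d [τ, σ, v] = v`. -/
def Subdivision.d : Subdivision C ⥤ C where
  obj τ := τ.simplex.obj 0
  map v := v.1

end Subdivision

section Modules

variable {k : Type u} [CommRing k] {C D : Type u} [Category.{u} C] [Category.{u} D]

/-- The category of left modules over a diagram `A : Cᵒᵖ ⥤ k-alg`: presheaves of abelian groups
`M` on `C` with an `A(i)`-module structure on each `M(i)` for which the restriction maps are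
linear. -/
abbrev Mod (A : Cᵒᵖ ⥤ AlgCat.{u} k) : Type (u + 1) :=
  PresheafOfModules.{u} (A ⋙ forget₂ (AlgCat.{u} k) RingCat.{u})

/-- The structure map `k → A(i)`. -/
abbrev structureMap (A : Cᵒᵖ ⥤ AlgCat.{u} k) (i : C) :
    k →+* (A ⋙ forget₂ (AlgCat.{u} k) RingCat.{u}).obj (op i) :=
  algebraMap k (A.obj (op i))

/-- The functor which sends an `A`-module `M` to the `k`-module underlying `M(i)`. -/
abbrev toModuleCat (A : Cᵒᵖ ⥤ AlgCat.{u} k) (i : C) : Mod A ⥤ ModuleCat.{u} k :=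
  PresheafOfModules.evaluation _ (op i) ⋙ ModuleCat.restrictScalars (structureMap A i)

instance {R S : Type u} [Ring R] [Ring S] (f : R →+* S) :
    PreservesFiniteLimits (ModuleCat.restrictScalars.{u} f) where
  preservesFiniteLimits J _ _ := ⟨fun {K} ↦ by
    have : PreservesLimit K (ModuleCat.restrictScalars.{u} f ⋙ forget₂ _ AddCommGrpCat.{u}) :=
      inferInstanceAs (PreservesLimit K (forget₂ (ModuleCat.{u} S) AddCommGrpCat.{u}))
    exact preservesLimit_of_reflects_of_preserves _ (forget₂ _ AddCommGrpCat.{u})⟩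

instance (A : Cᵒᵖ ⥤ AlgCat.{u} k) (i : C) : PreservesFiniteLimits (toModuleCat A i) :=
  inferInstance

instance (A : Cᵒᵖ ⥤ AlgCat.{u} k) (i : C) : PreservesFiniteColimits (toModuleCat A i) :=
  inferInstance

/-- The multiple `c • φ` of a morphism of `A`-modules, for `c` in `k`: `(c • φ)(m) = c φ(m)`. -/
def smulHom {A : Cᵒᵖ ⥤ AlgCat.{u} k} {M N : Mod A} (c : k) (φ : M ⟶ N) : M ⟶ N where
  app X := ModuleCat.ofHom
    { toFun m := structureMap A X.unop c • φ.app X m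
      map_add' m m' := by rw [map_add, smul_add]
      map_smul' a m := by
        rw [map_smul, smul_smul, smul_smul, RingHom.id_apply]
        congr 1
        exact Algebra.commutes (A := A.obj X) c a }
  naturality {X Y} g := by
    ext m
    have h₁ := PresheafOfModules.naturality_apply φ g m
    have h₂ := N.map_smul g (structureMap A X.unop c) (φ.app X m)
    have h₃ : (A ⋙ forget₂ (AlgCat.{u} k) RingCat.{u}).map g (structureMap A X.unop c) =
      structureMap A Y.unop c := (A.map g).hom.commutes c
    rw [h₃] at h₂
    change structureMap A Y.unop c • φ.app Y (M.map g m) =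
      N.map g (structureMap A X.unop c • φ.app X m)
    rw [h₁, h₂]
    rfl

lemma smulHom_app_apply {A : Cᵒᵖ ⥤ AlgCat.{u} k} {M N : Mod A} (c : k) (φ : M ⟶ N) (X : Cᵒᵖ)
    (m : M.obj X) : (smulHom c φ).app X m = structureMap A X.unop c • φ.app X m := rfl

/-- The category of `A`-modules is `k`-linear. -/
instance (A : Cᵒᵖ ⥤ AlgCat.{u} k) : Linear k (Mod A) where
  homModule M N :=
    { smul c φ := smulHom c φ
      one_smul φ := by
        ext X m
        change structureMap A X.unop 1 • φ.app X m = φ.app X m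
        rw [map_one, one_smul]
      mul_smul c d φ := by
        ext X m
        change structureMap A X.unop (c * d) • φ.app X m =
          structureMap A X.unop c • structureMap A X.unop d • φ.app X m
        rw [map_mul, mul_smul]
      smul_zero c := by
        ext X m
        change structureMap A X.unop c • (0 : N.obj X) = 0
        rw [smul_zero]
      smul_add c φ ψ := by
        ext X m
        change structureMap A X.unop c • (φ.app X m + ψ.app X m) =
          structureMap A X.unop c • φ.app X m + structureMap A X.unop c • ψ.app X m
        rw [smul_add]
      add_smul c d φ := by
        ext X m
        change structureMap A X.unop (c + d) • φ.app X m =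
          structureMap A X.unop c • φ.app X m + structureMap A X.unop d • φ.app X m
        rw [map_add, add_smul]
      zero_smul φ := by
        ext X m
        change structureMap A X.unop 0 • φ.app X m = 0
        rw [map_zero, zero_smul] }
  smul_comp L M N c φ ψ := by
    ext X m
    change ψ.app X (structureMap A X.unop c • φ.app X m) =
      structureMap A X.unop c • ψ.app X (φ.app X m)
    rw [map_smul]
  comp_smul L M N φ c ψ := rfl

/-- For a functor `f : D ⥤ C` and a diagram `A` over `C`, the functor `f^*` from `A`-modules to
modules over the diagram `f^* A`, given by `(f^* M)(σ) = M(f σ)`. -/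
def pullbackFunctor (f : D ⥤ C) (A : Cᵒᵖ ⥤ AlgCat.{u} k) : Mod A ⥤ Mod (f.op ⋙ A) :=
  PresheafOfModules.pushforward₀ f (A ⋙ forget₂ (AlgCat.{u} k) RingCat.{u})

instance (f : D ⥤ C) (A : Cᵒᵖ ⥤ AlgCat.{u} k) : PreservesFiniteLimits (pullbackFunctor f A) where
  preservesFiniteLimits _ _ _ := ⟨fun {_} ↦ ⟨fun {_} hc ↦
    ⟨PresheafOfModules.evaluationJointlyReflectsLimits _ _ fun X ↦
      isLimitOfPreserves (PresheafOfModules.evaluation _ (f.op.obj X)) hc⟩⟩⟩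

instance (f : D ⥤ C) (A : Cᵒᵖ ⥤ AlgCat.{u} k) : PreservesFiniteColimits (pullbackFunctor f A) where
  preservesFiniteColimits _ _ _ := ⟨fun {_} ↦ ⟨fun {_} hc ↦
    ⟨PresheafOfModules.evaluationJointlyReflectsColimits _ _ fun X ↦
      isColimitOfPreserves (PresheafOfModules.evaluation _ (f.op.obj X)) hc⟩⟩⟩

lemma allowable_pullbackFunctor (f : D ⥤ C) (A : Cᵒᵖ ⥤ AlgCat.{u} k) ⦃M N : Mod A⦄ (φ : M ⟶ N)
    (h : RelYoneda.Allowable (toModuleCat A) φ) :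
    RelYoneda.Allowable (toModuleCat (f.op ⋙ A)) ((pullbackFunctor f A).map φ) :=
  fun σ ↦ h (f.obj σ)

/-- The relative Yoneda cohomology `Ext^n_{A,k}(M, N)` of modules over a diagram `A` of
`k`-algebras: classes of `n`-fold extensions of `M` by `N` in which all maps are allowable, i.e.
have objectwise `k`-linear splitting maps. -/
abbrev Ext (A : Cᵒᵖ ⥤ AlgCat.{u} k) (n : ℕ) (M N : Mod A) : Type (u + 1) :=
  RelYoneda.Ext (toModuleCat A) n M N

/-- The subdivision `A' = d^* A` of a diagram `A` over `C`. -/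
abbrev subdivide (A : Cᵒᵖ ⥤ AlgCat.{u} k) : (Subdivision C)ᵒᵖ ⥤ AlgCat.{u} k :=
  (Subdivision.d C).op ⋙ A

/-- The functor `d^*`, which sends an `A`-module `M` to the `A'`-module `M'`. -/
abbrev dStar (A : Cᵒᵖ ⥤ AlgCat.{u} k) : Mod A ⥤ Mod (subdivide A) :=
  pullbackFunctor (Subdivision.d C) A

/-- The map `Ext^n_{A,k}(M, N) → Ext^n_{A',k}(M', N')`, `[E] ↦ [E']`, induced by `d^*`. -/
def extSubdivide (A : Cᵒᵖ ⥤ AlgCat.{u} k) (n : ℕ) (M N : Mod A) :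
    Ext A n M N → Ext (subdivide A) n ((dStar A).obj M) ((dStar A).obj N) :=
  RelYoneda.Ext.map (dStar A) (allowable_pullbackFunctor (Subdivision.d C) A)

end Modules

end Diagram

end

universe u

noncomputable section

namespace RelYoneda

universe v v' v₁ u' u₁ w w'

section Splicing

variable {𝒜 : Type u} [Category.{v} 𝒜] [Abelian 𝒜] {ℬ : Type u'} [Category.{v'} ℬ] [Abelian ℬ]
  {ι : Type w} {U : ι → 𝒜 ⥤ ℬ} [∀ i, PreservesFiniteLimits (U i)]
  [∀ i, PreservesFiniteColimits (U i)]

variable {N N' Q Q' K K' M M' : 𝒜} {n : ℕ}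

namespace AllowableSES

lemma Mor.pull_map {S : AllowableSES U N M} {T : AllowableSES U N' M'} {α : N ⟶ N'} {β : M ⟶ M'}
    (h : Mor S T α β) {L L' : 𝒜} {f : L ⟶ M} {g : L' ⟶ M'} {γ : L ⟶ L'} (w : f ≫ β = γ ≫ g) :
    Mor (S.pull f) (T.pull g) α γ := by
  obtain ⟨e, h₁, h₂⟩ := h
  refine ⟨pullback.lift (pullback.fst _ _ ≫ e) (pullback.snd _ _ ≫ γ) ?_, ?_, ?_⟩
  · rw [Category.assoc, ← h₂, pullback.condition_assoc, w, Category.assoc]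
  · dsimp [AllowableSES.pull, ofKernel]
    apply pullback.hom_ext
    · simp [pullback.lift_fst, pullback.lift_fst_assoc, h₁]
    · simp [pullback.lift_snd, pullback.lift_snd_assoc]
  · dsimp [AllowableSES.pull, ofKernel]
    rw [pullback.lift_snd]

lemma Mor.push_map {S : AllowableSES U N M} {T : AllowableSES U N' M'} {α : N ⟶ N'} {β : M ⟶ M'}
    (h : Mor S T α β) {L L' : 𝒜} {f : N ⟶ L} {g : N' ⟶ L'} {γ : L ⟶ L'} (w : f ≫ γ = α ≫ g) :
    Mor (S.push f) (T.push g) γ β := by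
  obtain ⟨e, h₁, h₂⟩ := h
  refine ⟨pushout.desc (e ≫ pushout.inl _ _) (γ ≫ pushout.inr _ _) ?_, ?_, ?_⟩
  · rw [reassoc_of% h₁, pushout.condition, reassoc_of% w]
  · dsimp [AllowableSES.push, ofCokernel]
    rw [pushout.inr_desc]
  · dsimp [AllowableSES.push, ofCokernel]
    apply pushout.hom_ext
    · simp [pushout.inl_desc, pushout.inl_desc_assoc, h₂]
    · simp [pushout.inr_desc, pushout.inr_desc_assoc]

lemma mor_codiag (S : AllowableSES U N M) :
    Mor (S.sum S) S (biprod.desc (𝟙 _) (𝟙 _)) (biprod.desc (𝟙 _) (𝟙 _)) := by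
  refine ⟨biprod.desc (𝟙 _) (𝟙 _), ?_, ?_⟩ <;> dsimp [AllowableSES.sum, ofKernel] <;> ext <;> simp

end AllowableSES

namespace Extension

/-- The splice of an extension of `K` by `N` with a short exact sequence
`0 ⟶ K ⟶ P ⟶ M ⟶ 0`. -/
def prepend (S : AllowableSES U K M) : ∀ {n : ℕ}, Extension U N n K → Extension U N (n + 1) M
  | 0, .hom f => .short (S.push f)
  | _ + 1, E => .cons S E

/-- The splice of an extension of `M` by `Q` with a short exact sequence
`0 ⟶ N ⟶ J ⟶ Q ⟶ 0`. -/
def append (T : AllowableSES U N Q) : ∀ {n : ℕ} {M : 𝒜}, Extension U Q n M →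
    Extension U N (n + 1) M
  | _, _, .hom f => .short (T.pull f)
  | _, _, .short S => .cons S (.short T)
  | _, _, .cons S E => .cons S (append T E)

lemma Mor.prepend {S : AllowableSES U K M} {S' : AllowableSES U K' M'} {κ : K ⟶ K'}
    {β : M ⟶ M'} (h : AllowableSES.Mor S S' κ β) {α : N ⟶ N'} {E : Extension U N n K}
    {F : Extension U N' n K'} (h' : Mor α E F κ) : Mor α (E.prepend S) (F.prepend S') β := by
  cases n with
  | zero =>
    cases E; cases F
    exact h.push_map h'
  | succ n => exact ⟨κ, h, h'⟩

lemma Mor.append {T : AllowableSES U N Q} {T' : AllowableSES U N' Q'} {α : N ⟶ N'}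
    {γ : Q ⟶ Q'} (h : AllowableSES.Mor T T' α γ) {β : M ⟶ M'} {E : Extension U Q n M}
    {F : Extension U Q' n M'} (h' : Mor γ E F β) : Mor α (E.append T) (F.append T') β := by
  induction E generalizing M' with
  | hom f => cases F; exact h.pull_map h'
  | short S => cases F; exact ⟨γ, h', h⟩
  | cons S E ih =>
    cases F
    obtain ⟨κ, h₁, h₂⟩ := h'
    exact ⟨κ, h₁, ih h₂⟩

end Extension

namespace Ext

lemma zero_push_mk_eq {E : Extension U N n M} {F : Extension U N' n M} {α : N ⟶ N'}
    (h : Extension.Mor α E F (𝟙 M)) : push α (mk E) = mk F := by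
  rw [push_mk_eq h, pull_id]

lemma zero_pull_mk_eq {E : Extension U N n M} {F : Extension U N n M'} {β : M ⟶ M'}
    (h : Extension.Mor (𝟙 N) E F β) : mk E = pull β (mk F) := by
  rw [← push_mk_eq h, push_id]

lemma push_map_zero (α : N ⟶ N') : push α (0 : Ext U n M N) = 0 := by
  rw [← push_zero (0 : Ext U n M N) (N' := N), push_push, zero_comp, push_zero]

lemma pull_map_zero (β : M' ⟶ M) : pull β (0 : Ext U n M N) = 0 := by
  rw [← push_zero (0 : Ext U n M N) (N' := N), ← push_pull, push_zero]

lemma push_sub (α : N ⟶ N') (ξ η : Ext U n M N) : push α (ξ - η) = push α ξ - push α η := by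
  rw [eq_sub_iff_add_eq, ← push_add, sub_add_cancel]

/-- The map `Ext^n(K, N) → Ext^(n+1)(M, N)` given by the splice with a short exact sequence
`0 ⟶ K ⟶ P ⟶ M ⟶ 0`. -/
def prepend (S : AllowableSES U K M) : Ext U n K N → Ext U (n + 1) M N :=
  Quot.map (fun E ↦ E.prepend S) fun _ _ h ↦ Extension.Mor.prepend (.id S) h

/-- The map `Ext^n(M, Q) → Ext^(n+1)(M, N)` given by the splice with a short exact sequence
`0 ⟶ N ⟶ J ⟶ Q ⟶ 0`. -/
def append (T : AllowableSES U N Q) : Ext U n M Q → Ext U (n + 1) M N :=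
  Quot.map (fun E ↦ E.append T) fun _ _ h ↦ Extension.Mor.append (.id T) h

lemma prepend_push (S : AllowableSES U K M) (α : N ⟶ N') (ξ : Ext U n K N) :
    prepend S (push α ξ) = push α (prepend S ξ) := by
  obtain ⟨E, rfl⟩ := mk_surjective ξ
  exact (zero_push_mk_eq (Extension.Mor.prepend (.id S) (E.mor_push α))).symm

lemma prepend_pull {S : AllowableSES U K M} {S' : AllowableSES U K' M'} {κ : K ⟶ K'} {β : M ⟶ M'}
    (h : AllowableSES.Mor S S' κ β) (ξ : Ext U n K' N) :
    prepend S (pull κ ξ) = pull β (prepend S' ξ) := by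
  obtain ⟨E, rfl⟩ := mk_surjective ξ
  exact zero_pull_mk_eq (Extension.Mor.prepend h (E.mor_pull κ))

lemma append_pull (T : AllowableSES U N Q) (β : M' ⟶ M) (ξ : Ext U n M Q) :
    append T (pull β ξ) = pull β (append T ξ) := by
  obtain ⟨E, rfl⟩ := mk_surjective ξ
  exact zero_pull_mk_eq (Extension.Mor.append (.id T) (E.mor_pull β))

lemma append_push {T : AllowableSES U N Q} {T' : AllowableSES U N' Q'} {α : N ⟶ N'} {γ : Q ⟶ Q'}
    (h : AllowableSES.Mor T T' α γ) (ξ : Ext U n M Q) :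
    append T' (push γ ξ) = push α (append T ξ) := by
  obtain ⟨E, rfl⟩ := mk_surjective ξ
  exact (zero_push_mk_eq (Extension.Mor.append h (E.mor_push γ))).symm

lemma prepend_sum (S : AllowableSES U K M) (S' : AllowableSES U K' M') (ξ : Ext U n K N)
    (η : Ext U n K' N') : prepend (S.sum S') (sum ξ η) = sum (prepend S ξ) (prepend S' η) := by
  obtain ⟨E, rfl⟩ := mk_surjective ξ
  obtain ⟨F, rfl⟩ := mk_surjective η
  cases n with
  | zero =>
    cases E; cases F
    exact (sum_push _ _ (mk (.short S)) (mk (.short S'))).symm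
  | succ n => rfl

lemma append_sum (T : AllowableSES U N Q) (T' : AllowableSES U N' Q') (ξ : Ext U n M Q)
    (η : Ext U n M' Q') : append (T.sum T') (sum ξ η) = sum (append T ξ) (append T' η) := by
  obtain ⟨E, rfl⟩ := mk_surjective ξ
  obtain ⟨F, rfl⟩ := mk_surjective η
  induction E generalizing M' with
  | hom f => cases F; exact (sum_pull _ _ (mk (.short T)) (mk (.short T'))).symm
  | short S => cases F; rfl
  | cons S E ih =>
    cases F with
    | cons S' F => exact congrArg (prepend (S.sum S')) (ih F)

lemma prepend_append (S : AllowableSES U K M) (T : AllowableSES U N Q) (ξ : Ext U n K Q) :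
    prepend S (append T ξ) = append T (prepend S ξ) := by
  obtain ⟨E, rfl⟩ := mk_surjective ξ
  cases n with
  | zero =>
    cases E with
    | hom f =>
      have h : Extension.Mor (𝟙 N) (.cons S (.short (T.pull f)))
          (.cons (S.push f) (.short T)) (𝟙 M) := ⟨f, S.mor_push f, T.mor_pull f⟩
      exact mk_eq h
  | succ n => cases E <;> rfl

lemma prepend_add (S : AllowableSES U K M) (ξ η : Ext U n K N) :
    prepend S (ξ + η) = prepend S ξ + prepend S η := by
  rw [add_def, add_def, prepend_push, prepend_pull S.mor_diag, prepend_sum]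

lemma append_add (T : AllowableSES U N Q) (ξ η : Ext U n M Q) :
    append T (ξ + η) = append T ξ + append T η := by
  rw [add_def, add_def, append_push T.mor_codiag, append_pull, append_sum]

lemma prepend_zero (S : AllowableSES U K M) : prepend S (0 : Ext U n K N) = 0 := by
  have h := prepend_add S (0 : Ext U n K N) 0
  rw [add_zero] at h
  exact left_eq_add.mp h

lemma append_zero (T : AllowableSES U N Q) : append T (0 : Ext U n M Q) = 0 := by
  have h := append_add T (0 : Ext U n M Q) 0
  rw [add_zero] at h
  exact left_eq_add.mp h

lemma append_sub (T : AllowableSES U N Q) (ξ η : Ext U n M Q) :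
    append T (ξ - η) = append T ξ - append T η := by
  rw [eq_sub_iff_add_eq, ← append_add, sub_add_cancel]

lemma append_push_proj (T : AllowableSES U N Q) (ω : Ext U n M T.E) :
    append T (push T.proj ω) = 0 := by
  have h : AllowableSES.Mor (.split N T.E : AllowableSES U N T.E) T (𝟙 N) T.proj := ⟨biprod.desc T.inc (𝟙 _), by simp, by
    dsimp [AllowableSES.split]; ext <;> simp [T.zero]⟩
  have h' : AllowableSES.Mor (.split N T.E : AllowableSES U N T.E)
      (.split N T.E : AllowableSES U N T.E) (𝟙 N) 0 :=
    ⟨biprod.fst ≫ biprod.inl, by simp, by simp⟩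
  rw [append_push h, ← append_push h', push_zero, append_zero]

lemma mk_hom_eq_push (f : M ⟶ N) : (mk (.hom f) : Ext U 0 M N) = push f (mk (.hom (𝟙 M))) :=
  congrArg (fun g ↦ (mk (.hom g) : Ext U 0 M N)) (Category.id_comp f).symm

lemma mk_hom_add (f g : M ⟶ N) :
    (mk (.hom (f + g)) : Ext U 0 M N) = mk (.hom f) + mk (.hom g) := by
  rw [mk_hom_eq_push, add_push, ← mk_hom_eq_push, ← mk_hom_eq_push]

lemma mk_hom_injective {f g : M ⟶ N} (h : (mk (.hom f) : Ext U 0 M N) = mk (.hom g)) : f = g := by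
  have h' := Quot.eqvGen_exact h
  have key : ∀ E F : Extension U N 0 M, Relation.EqvGen Extension.Step E F → E = F := by
    intro E F h
    induction h with
    | rel E F h =>
      cases E; cases F
      simpa [Extension.Step, Extension.Mor] using h
    | refl => rfl
    | symm _ _ _ h => exact h.symm
    | trans _ _ _ _ _ h h' => exact h.trans h'
  simpa using key _ _ h'

end Ext

end Splicing

section Injectives

variable {𝒜 : Type u} [Category.{v} 𝒜] [Abelian 𝒜] {ℬ : Type u'} [Category.{v'} ℬ] [Abelian ℬ]
  {ι : Type w} (U : ι → 𝒜 ⥤ ℬ)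

/-- An object is relatively injective if morphisms to it extend along the inclusions of allowable
short exact sequences. -/
def RelInjective (I : 𝒜) : Prop :=
  ∀ ⦃N M : 𝒜⦄ (S : AllowableSES U N M) (f : N ⟶ I), ∃ g : S.E ⟶ I, S.inc ≫ g = f

/-- Every object embeds into a relatively injective one by an allowable short exact sequence. -/
def EnoughRelInjectives : Prop :=
  ∀ N : 𝒜, ∃ (Q : 𝒜) (T : AllowableSES U N Q), RelInjective U T.E

variable {U} [∀ i, PreservesFiniteLimits (U i)]
  [∀ i, PreservesFiniteColimits (U i)] {N Q M M' : 𝒜} {n : ℕ}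

namespace RelInjective

lemma ext_eq_zero {I : 𝒜} (hI : RelInjective U I) (ξ : Ext U (n + 1) M I) : ξ = 0 := by
  obtain ⟨E, rfl⟩ := Ext.mk_surjective ξ
  induction n generalizing M with
  | zero =>
    cases E with
    | short S =>
      obtain ⟨r, hr⟩ := hI S (𝟙 _)
      exact Ext.mk_eq (F := .short (.split I M)) ⟨biprod.lift r S.proj, by
        dsimp [AllowableSES.split]; ext <;> simp [hr, S.zero], by simp⟩
  | succ n ih =>
    cases E with
    | cons S E =>
      change Ext.prepend S (Ext.mk E) = 0
      rw [ih, Ext.prepend_zero]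

lemma append_surjective (T : AllowableSES U N Q) (hI : RelInjective U T.E)
    (ξ : Ext U (n + 1) M N) : ∃ ζ, Ext.append T ζ = ξ := by
  obtain ⟨E, rfl⟩ := Ext.mk_surjective ξ
  induction n generalizing M with
  | zero =>
    cases E with
    | short S =>
      obtain ⟨e, he⟩ := hI S T.inc
      obtain ⟨f, hf⟩ := S.exists_desc (e ≫ T.proj) (by rw [reassoc_of% he, T.zero])
      refine ⟨Ext.mk (.hom f), (Ext.zero_pull_mk_eq (β := f) (E := .short S) (F := .short T)
        ⟨e, by rw [he, Category.id_comp], hf⟩).symm⟩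
  | succ n ih =>
    cases E with
    | cons S E =>
      obtain ⟨ζ, hζ⟩ := ih E
      exact ⟨Ext.prepend S ζ, by rw [← Ext.prepend_append, hζ]; rfl⟩

end RelInjective

/-- The class `ζ` is obtained from the extension by extending the morphism `N ⟶ J` to the
extension, for a short exact sequence `0 ⟶ N ⟶ J ⟶ Q ⟶ 0`. -/
def Extension.IsShift (T : AllowableSES U N Q) : ∀ {n : ℕ} {M : 𝒜}, Extension U N n M →
    Ext U (n - 1) M Q → Prop
  | _, _, .hom _, _ => False
  | _, _, .short S, ζ => ∃ f, AllowableSES.Mor S T (𝟙 N) f ∧ ζ = Ext.mk (.hom f)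
  | _, _, .cons (n := n) S E, ζ => ∃ ζ' : Ext U n _ Q, E.IsShift T ζ' ∧ ζ = Ext.prepend S ζ'

namespace Extension

lemma exists_isShift {T : AllowableSES U N Q} (hI : RelInjective U T.E)
    (E : Extension U N (n + 1) M) : ∃ ζ : Ext U n M Q, E.IsShift T ζ := by
  induction n generalizing M with
  | zero =>
    cases E with
    | short S =>
      obtain ⟨e, he⟩ := hI S T.inc
      obtain ⟨f, hf⟩ := S.exists_desc (e ≫ T.proj) (by rw [reassoc_of% he, T.zero])
      exact ⟨_, f, ⟨e, by rw [he, Category.id_comp], hf⟩, rfl⟩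
  | succ n ih =>
    cases E with
    | cons S E =>
      obtain ⟨ζ, hζ⟩ := ih E
      exact ⟨_, ζ, hζ, rfl⟩

lemma IsShift.unique {T : AllowableSES U N Q} {E : Extension U N (n + 1) M} {ζ ζ' : Ext U n M Q}
    (h : E.IsShift T ζ) (h' : E.IsShift T ζ') : ∃ ω, ζ = ζ' + Ext.push T.proj ω := by
  induction n generalizing M with
  | zero =>
    cases E with
    | short S =>
      obtain ⟨f, ⟨e, h₁, h₂⟩, rfl⟩ := h
      obtain ⟨f', ⟨e', h₁', h₂'⟩, rfl⟩ := h'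
      obtain ⟨l, hl⟩ := S.exists_desc (e - e') (by rw [Preadditive.comp_sub, h₁, h₁', sub_self])
      refine ⟨Ext.mk (.hom l), ?_⟩
      change _ = _ + Ext.mk (.hom (l ≫ T.proj))
      rw [← Ext.mk_hom_add]
      congr 2
      rw [← cancel_epi S.proj, Preadditive.comp_add, reassoc_of% hl, h₂, h₂',
        Preadditive.sub_comp, add_sub_cancel]
  | succ n ih =>
    cases E with
    | cons S E =>
      obtain ⟨ζ, h, rfl⟩ := h
      obtain ⟨ζ', h', rfl⟩ := h'
      obtain ⟨ω, hω⟩ := ih h h'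
      exact ⟨Ext.prepend S ω, by rw [← Ext.prepend_push, ← Ext.prepend_add]; exact congrArg _ hω⟩

lemma IsShift.pull {T : AllowableSES U N Q} {E : Extension U N (n + 1) M}
    {F : Extension U N (n + 1) M'} {β : M ⟶ M'} (h : Mor (𝟙 N) E F β) {ζ : Ext U n M' Q}
    (hζ : F.IsShift T ζ) : E.IsShift T (Ext.pull β ζ : Ext U n M Q) := by
  induction n generalizing M M' with
  | zero =>
    cases E with
    | short S =>
      cases F with
      | short S' =>
        obtain ⟨f, hf, rfl⟩ := hζ
        have h' : AllowableSES.Mor S S' (𝟙 N) β := h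
        exact ⟨β ≫ f, by simpa using h'.comp hf, rfl⟩
  | succ n ih =>
    cases E with
    | cons S E =>
      cases F with
      | cons S' F =>
        obtain ⟨κ, h₁, h₂⟩ := h
        obtain ⟨ζ, hζ, rfl⟩ := hζ
        exact ⟨_, ih h₂ hζ, (Ext.prepend_pull h₁ ζ).symm⟩

lemma isShift_append (T : AllowableSES U N Q) (E : Extension U Q n M) :
    (E.append T).IsShift T (Ext.mk E) := by
  induction E with
  | hom f => exact ⟨f, T.mor_pull f, rfl⟩
  | short S => exact ⟨_, ⟨𝟙 _, .id T, rfl⟩, (Ext.push_id (Ext.mk (.short S))).symm⟩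
  | cons S E ih => exact ⟨_, ih, rfl⟩

lemma isShift_trivial (T : AllowableSES U N Q) :
    (trivial N (n + 1) M).IsShift T (0 : Ext U n M Q) := by
  induction n generalizing M with
  | zero =>
    exact ⟨0, ⟨biprod.fst ≫ T.inc, by simp, by simp [T.zero]⟩, rfl⟩
  | succ n ih => exact ⟨_, ih, (Ext.prepend_zero _).symm⟩

end Extension

lemma RelInjective.exists_of_append_eq_zero {T : AllowableSES U N Q} (hI : RelInjective U T.E)
    {ζ : Ext U n M Q} (h : Ext.append T ζ = 0) : ∃ ω, Ext.push T.proj ω = ζ := by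
  obtain ⟨E, rfl⟩ := Ext.mk_surjective ζ
  have key : ∀ E F : Extension U N (n + 1) M, Relation.EqvGen Extension.Step E F →
      ∀ ζ ζ' : Ext U n M Q, E.IsShift T ζ → F.IsShift T ζ' → ∃ ω, ζ = ζ' + Ext.push T.proj ω := by
    intro E F h
    induction h with
    | rel E F h =>
      intro ζ ζ' hζ hζ'
      have := hζ'.pull h
      rw [Ext.pull_id] at this
      exact hζ.unique this
    | refl E => exact fun ζ ζ' hζ hζ' ↦ hζ.unique hζ'
    | symm E F _ ih =>
      intro ζ ζ' hζ hζ'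
      obtain ⟨ω, hω⟩ := ih ζ' ζ hζ' hζ
      refine ⟨0 - ω, ?_⟩
      rw [hω, Ext.push_sub, Ext.push_map_zero]
      abel
    | trans E F G _ _ ih ih' =>
      intro ζ ζ' hζ hζ'
      obtain ⟨ζ'', hζ''⟩ := F.exists_isShift hI
      obtain ⟨ω, hω⟩ := ih _ _ hζ hζ''
      obtain ⟨ω', hω'⟩ := ih' _ _ hζ'' hζ'
      refine ⟨ω' + ω, ?_⟩
      rw [hω, hω', Ext.push_add, add_assoc]
  obtain ⟨ω, hω⟩ := key _ _ (Quot.eqvGen_exact h) _ 0 (Extension.isShift_append T E)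
    (Extension.isShift_trivial T)
  exact ⟨ω, by rw [hω, zero_add]⟩

end Injectives

section LongExactSequence

variable {𝒜 : Type u} [Category.{v} 𝒜] [Abelian 𝒜] {ℬ : Type u'} [Category.{v'} ℬ] [Abelian ℬ]
  {ι : Type w} {U : ι → 𝒜 ⥤ ℬ} [∀ i, PreservesFiniteLimits (U i)]
  [∀ i, PreservesFiniteColimits (U i)] {N J Q Q' M : 𝒜}

namespace AllowableSES

/-- For short exact sequences `0 ⟶ N ⟶ J ⟶ Q ⟶ 0` and `0 ⟶ J ⟶ I ⟶ Q' ⟶ 0`, the short exact sequence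
`0 ⟶ N ⟶ I ⟶ I / N ⟶ 0`. -/
abbrev comp (T : AllowableSES U N Q) (V : AllowableSES U T.E Q') :
    AllowableSES U N (V.push T.proj).E :=
  ofCokernel (E := V.E) (T.inc ≫ V.inc) (pushout.inl V.inc T.proj)
    (by rw [Category.assoc, pushout.condition, reassoc_of% T.zero, zero_comp])
    (fun {A} k hk ↦ by
      obtain ⟨l, hl⟩ := T.exists_desc (V.inc ≫ k) (by rw [← hk, Category.assoc])
      exact ⟨pushout.desc k l hl.symm, pushout.inl_desc _ _ _⟩)
    inferInstance inferInstance
    (fun i ↦ by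
      obtain ⟨r, hr⟩ := T.exists_retraction i
      obtain ⟨r', hr'⟩ := V.exists_retraction i
      exact ⟨r' ≫ r, by rw [Functor.map_comp, Category.assoc, reassoc_of% hr', hr]⟩)

lemma mor_comp (T : AllowableSES U N Q) (V : AllowableSES U T.E Q') :
    Mor T (T.comp V) (𝟙 N) (V.push T.proj).inc :=
  ⟨V.inc, by simp [comp, ofCokernel], pushout.condition.symm⟩

lemma comp_mor (T : AllowableSES U N Q) (V : AllowableSES U T.E Q') :
    Mor (T.comp V) V T.inc (V.push T.proj).proj :=
  ⟨𝟙 _, by simp [comp, ofCokernel], by simp [comp, ofCokernel, push, pushout.inl_desc]⟩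

lemma comp_proj_push_proj (T : AllowableSES U N Q) (V : AllowableSES U T.E Q') :
    (T.comp V).proj ≫ (V.push T.proj).proj = V.proj :=
  pushout.inl_desc _ _ _

end AllowableSES

/-- Exactness of `Ext^n(M, N) ⟶ Ext^n(M, J) ⟶ Ext^n(M, Q)`. -/
def ExactMiddle (U : ι → 𝒜 ⥤ ℬ) [∀ i, PreservesFiniteLimits (U i)]
    [∀ i, PreservesFiniteColimits (U i)] (n : ℕ) : Prop :=
  ∀ ⦃N Q M : 𝒜⦄ (T : AllowableSES U N Q) (ω : Ext U n M T.E),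
    Ext.push T.proj ω = 0 → ∃ ξ, Ext.push T.inc ξ = ω

/-- Exactness of `Ext^n(M, J) ⟶ Ext^n(M, Q) ⟶ Ext^(n+1)(M, N)`. -/
def ExactRight (U : ι → 𝒜 ⥤ ℬ) [∀ i, PreservesFiniteLimits (U i)]
    [∀ i, PreservesFiniteColimits (U i)] (n : ℕ) : Prop :=
  ∀ ⦃N Q M : 𝒜⦄ (T : AllowableSES U N Q) (ζ : Ext U n M Q),
    Ext.append T ζ = 0 → ∃ ω, Ext.push T.proj ω = ζ

/-- Exactness of `Ext^n(M, Q) ⟶ Ext^(n+1)(M, N) ⟶ Ext^(n+1)(M, J)`. -/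
def ExactLeft (U : ι → 𝒜 ⥤ ℬ) [∀ i, PreservesFiniteLimits (U i)]
    [∀ i, PreservesFiniteColimits (U i)] (n : ℕ) : Prop :=
  ∀ ⦃N Q M : 𝒜⦄ (T : AllowableSES U N Q) (ξ : Ext U (n + 1) M N),
    Ext.push T.inc ξ = 0 → ∃ ζ, Ext.append T ζ = ξ

lemma exactMiddle_zero : ExactMiddle U 0 := by
  intro N Q M T ω h
  obtain ⟨E, rfl⟩ := Ext.mk_surjective ω
  cases E with
  | hom f =>
    obtain ⟨l, rfl⟩ := T.exists_lift f (Ext.mk_hom_injective h)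
    exact ⟨Ext.mk (.hom l), rfl⟩

lemma exactMiddle_succ (hU : EnoughRelInjectives U) {n : ℕ} (h : ExactRight U n) :
    ExactMiddle U (n + 1) := by
  intro N Q M T ω hω
  obtain ⟨Q', V, hV⟩ := hU T.E
  obtain ⟨ω₁, rfl⟩ := hV.append_surjective V ω
  rw [← Ext.append_push (V.mor_push T.proj), Ext.push_id] at hω
  obtain ⟨ω₂, rfl⟩ := h _ _ hω
  exact ⟨Ext.append (T.comp V) ω₂, (Ext.append_push (T.comp_mor V) ω₂).symm⟩

lemma exactLeft (hU : EnoughRelInjectives U) {n : ℕ} (h : ExactMiddle U n) : ExactLeft U n := by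
  intro N Q M T ξ hξ
  obtain ⟨Q', V, hV⟩ := hU T.E
  obtain ⟨ζ, rfl⟩ := RelInjective.append_surjective (T.comp V) hV ξ
  rw [← Ext.append_push (T.comp_mor V)] at hξ
  obtain ⟨g, hg⟩ := hV.exists_of_append_eq_zero hξ
  obtain ⟨ω, hω⟩ := h (V.push T.proj) (ζ - Ext.push (T.comp V).proj g) (by
    rw [Ext.push_sub, Ext.push_push, AllowableSES.comp_proj_push_proj, hg, sub_self])
  refine ⟨ω, ?_⟩
  have h₁ := Ext.append_push (T.mor_comp V) ω
  rw [Ext.push_id, hω, Ext.append_sub, Ext.append_push_proj (T.comp V), sub_zero] at h₁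
  exact h₁.symm

lemma exactRight_zero (hU : EnoughRelInjectives U) : ExactRight U 0 := by
  intro N Q M T ζ hζ
  obtain ⟨Q', V, hV⟩ := hU T.E
  have hζ' : Ext.append (T.comp V) (Ext.push (V.push T.proj).inc ζ) = 0 := by
    rw [Ext.append_push (T.mor_comp V), hζ, Ext.push_map_zero]
  obtain ⟨g, hg⟩ := RelInjective.exists_of_append_eq_zero (T := T.comp V) hV hζ'
  have hg' : Ext.push V.proj g = 0 := by
    rw [← AllowableSES.comp_proj_push_proj T V, ← Ext.push_push, hg, Ext.push_push,
      (V.push T.proj).zero, Ext.push_zero]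
  obtain ⟨h, rfl⟩ := exactMiddle_zero V g hg'
  refine ⟨h, ?_⟩
  rw [Ext.push_push, show V.inc ≫ (T.comp V).proj = T.proj ≫ (V.push T.proj).inc from
    pushout.condition, ← Ext.push_push] at hg
  obtain ⟨E, rfl⟩ := Ext.mk_surjective h
  obtain ⟨F, rfl⟩ := Ext.mk_surjective ζ
  cases E; cases F
  exact congrArg (fun f ↦ Ext.mk (.hom f))
    ((cancel_mono (V.push T.proj).inc).mp (Ext.mk_hom_injective hg))

lemma exactRight_succ (hU : EnoughRelInjectives U) {n : ℕ} (h : ExactLeft U n) :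
    ExactRight U (n + 1) := by
  intro N Q M T ζ hζ
  obtain ⟨Q', V, hV⟩ := hU T.E
  have hζ' : Ext.append (T.comp V) (Ext.push (V.push T.proj).inc ζ) = 0 := by
    rw [Ext.append_push (T.mor_comp V), hζ, Ext.push_map_zero]
  obtain ⟨g, hg⟩ := RelInjective.exists_of_append_eq_zero (T := T.comp V) hV hζ'
  rw [RelInjective.ext_eq_zero hV g, Ext.push_map_zero] at hg
  obtain ⟨ω, rfl⟩ := h (V.push T.proj) ζ hg.symm
  refine ⟨Ext.append V ω, ?_⟩
  rw [← Ext.append_push (V.mor_push T.proj), Ext.push_id]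

/-- The long exact sequence of relative Yoneda cohomology in the second variable. -/
lemma longExactSequence (hU : EnoughRelInjectives U) (n : ℕ) :
    ExactMiddle U n ∧ ExactRight U n ∧ ExactLeft U n := by
  induction n with
  | zero => exact ⟨exactMiddle_zero, exactRight_zero hU, exactLeft hU exactMiddle_zero⟩
  | succ n ih =>
    have h := exactMiddle_succ hU ih.2.1
    exact ⟨h, exactRight_succ hU ih.2.2, exactLeft hU h⟩

end LongExactSequence

section Functoriality

variable {𝒜 : Type u} [Category.{v} 𝒜] [Abelian 𝒜] {ℬ : Type u'} [Category.{v'} ℬ] [Abelian ℬ]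
  {𝒜' : Type u₁} [Category.{v₁} 𝒜'] [Abelian 𝒜'] {ι : Type w} {ι' : Type w'}
  {U : ι → 𝒜 ⥤ ℬ} {U' : ι' → 𝒜' ⥤ ℬ}
  [∀ i, PreservesFiniteLimits (U i)] [∀ i, PreservesFiniteColimits (U i)]
  [∀ i, PreservesFiniteLimits (U' i)] [∀ i, PreservesFiniteColimits (U' i)]
  (F : 𝒜 ⥤ 𝒜') [PreservesFiniteLimits F] [PreservesFiniteColimits F]
  (hF : ∀ ⦃X Y : 𝒜⦄ (f : X ⟶ Y), Allowable U f → Allowable U' (F.map f))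

attribute [local instance] preservesZeroMorphisms_of_exact

variable {N N' Q M M' : 𝒜} {n : ℕ}

namespace Ext

lemma map_push (α : N ⟶ N') (ξ : Ext U n M N) :
    map F hF (push α ξ) = push (F.map α) (map F hF ξ) := by
  obtain ⟨E, rfl⟩ := mk_surjective ξ
  have h := (E.mor_push α).map F hF
  rw [F.map_id] at h
  exact (zero_push_mk_eq h).symm

lemma map_pull (β : M' ⟶ M) (ξ : Ext U n M N) :
    map F hF (pull β ξ) = pull (F.map β) (map F hF ξ) := by
  obtain ⟨E, rfl⟩ := mk_surjective ξ
  have h := (E.mor_pull β).map F hF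
  rw [F.map_id] at h
  exact zero_pull_mk_eq h

lemma map_biprod_map_comp_lift {X Y X' Y' : 𝒜} (f : X ⟶ X') (g : Y ⟶ Y') :
    F.map (biprod.map f g) ≫ biprod.lift (F.map biprod.fst) (F.map biprod.snd) =
      biprod.lift (F.map biprod.fst) (F.map biprod.snd) ≫ biprod.map (F.map f) (F.map g) := by
  ext <;> simp [← Functor.map_comp]

lemma ses_mor_map_sum (S : AllowableSES U N M) (T : AllowableSES U N' M') :
    AllowableSES.Mor ((S.sum T).map F hF) ((S.map F hF).sum (T.map F hF))
      (biprod.lift (F.map biprod.fst) (F.map biprod.snd))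
      (biprod.lift (F.map biprod.fst) (F.map biprod.snd)) :=
  ⟨biprod.lift (F.map biprod.fst) (F.map biprod.snd), map_biprod_map_comp_lift F S.inc T.inc,
    map_biprod_map_comp_lift F S.proj T.proj⟩

lemma mor_map_sum (E : Extension U N n M) (E' : Extension U N' n M') :
    Extension.Mor (biprod.lift (F.map biprod.fst) (F.map biprod.snd)) ((E.sum E').map F hF)
      ((E.map F hF).sum (E'.map F hF)) (biprod.lift (F.map biprod.fst) (F.map biprod.snd)) := by
  induction E generalizing M' with
  | hom f => cases E'; exact map_biprod_map_comp_lift F _ _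
  | short S => cases E'; exact ses_mor_map_sum F hF _ _
  | cons S E ih => cases E'; exact ⟨_, ses_mor_map_sum F hF _ _, ih _⟩

lemma map_add (ξ η : Ext U n M N) : map F hF (ξ + η) = map F hF ξ + map F hF η := by
  obtain ⟨E, rfl⟩ := mk_surjective ξ
  obtain ⟨E', rfl⟩ := mk_surjective η
  have := Functor.additive_of_preserves_binary_products F
  have h₁ : F.map (biprod.desc (𝟙 N) (𝟙 N)) =
      biprod.lift (F.map biprod.fst) (F.map biprod.snd) ≫ biprod.desc (𝟙 _) (𝟙 _) := by
    rw [biprod.lift_desc, Category.comp_id, Category.comp_id, ← F.map_add, biprod.desc_eq,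
      Category.comp_id, Category.comp_id]
  have h₂ : F.map (biprod.lift (𝟙 M) (𝟙 M)) ≫ biprod.lift (F.map biprod.fst) (F.map biprod.snd) =
      biprod.lift (𝟙 _) (𝟙 _) := by
    ext <;> simp [← Functor.map_comp]
  rw [add_def, add_def, map_push, map_pull, h₁, ← push_push, push_pull _ (F.map _),
    show map F hF (sum (mk E) (mk E')) = mk ((E.sum E').map F hF) from rfl,
    push_mk_eq (mor_map_sum F hF E E'), pull_pull, h₂]
  rfl

lemma map_zero : map F hF (0 : Ext U n M N) = 0 := by
  have h := map_add F hF (0 : Ext U n M N) 0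
  rw [add_zero] at h
  exact left_eq_add.mp h

lemma map_append (T : AllowableSES U N Q) (ζ : Ext U n M Q) :
    map F hF (append T ζ) = append (T.map F hF) (map F hF ζ) := by
  obtain ⟨E, rfl⟩ := mk_surjective ζ
  induction E with
  | hom f =>
    have h := (T.mor_pull f).map F hF
    rw [F.map_id] at h
    exact zero_pull_mk_eq (E := .short _) (F := .short (T.map F hF)) h
  | short S => rfl
  | cons S E ih => exact congrArg (prepend (S.map F hF)) ih

lemma map_id (h : ∀ ⦃X Y : 𝒜⦄ (f : X ⟶ Y), Allowable U f → Allowable U ((𝟭 𝒜).map f))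
    (ξ : Ext U n M N) : map (𝟭 𝒜) h ξ = ξ := by
  obtain ⟨E, rfl⟩ := mk_surjective ξ
  refine congrArg mk ?_
  induction E with
  | hom f => rfl
  | short S => rfl
  | cons S E ih => exact congrArg (Extension.cons S) ih

lemma map_comp {𝒜'' : Type*} [Category* 𝒜''] [Abelian 𝒜''] {κ : Type*} {V : κ → 𝒜'' ⥤ ℬ}
    (G : 𝒜' ⥤ 𝒜'') [PreservesFiniteLimits G] [PreservesFiniteColimits G]
    (hG : ∀ ⦃X Y : 𝒜'⦄ (f : X ⟶ Y), Allowable U' f → Allowable V (G.map f))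
    (hFG : ∀ ⦃X Y : 𝒜⦄ (f : X ⟶ Y), Allowable U f → Allowable V ((F ⋙ G).map f))
    (ξ : Ext U n M N) : map (F ⋙ G) hFG ξ = map G hG (map F hF ξ) := by
  obtain ⟨E, rfl⟩ := mk_surjective ξ
  refine congrArg mk ?_
  induction E with
  | hom f => rfl
  | short S => rfl
  | cons S E ih => exact congrArg (Extension.cons ((S.map F hF).map G hG)) ih

variable {F hF} {G : 𝒜 ⥤ 𝒜'} [PreservesFiniteLimits G] [PreservesFiniteColimits G]
  {hG : ∀ ⦃X Y : 𝒜⦄ (f : X ⟶ Y), Allowable U f → Allowable U' (G.map f)}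

/-- A natural transformation between exact functors acts on relative Yoneda cohomology. -/
lemma push_app_map (θ : F ⟶ G) (ξ : Ext U n M N) :
    push (θ.app N) (map F hF ξ) = pull (θ.app M) (map G hG ξ) := by
  obtain ⟨E, rfl⟩ := mk_surjective ξ
  refine push_mk_eq ?_
  induction E with
  | hom f => exact θ.naturality f
  | short S => exact ⟨θ.app _, θ.naturality _, θ.naturality _⟩
  | cons S E ih => exact ⟨θ.app _, ⟨θ.app _, θ.naturality _, θ.naturality _⟩, ih⟩

variable (F hF)

/-- A criterion for an exact functor to induce isomorphisms on relative Yoneda cohomology. -/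
theorem map_bijective [F.Full] [F.Faithful] (hU : EnoughRelInjectives U)
    (hU' : EnoughRelInjectives U')
    (h : ∀ N : 𝒜, ∃ (Q : 𝒜) (T : AllowableSES U N Q), ∀ (n : ℕ) (M : 𝒜),
      (∀ ξ : Ext U (n + 1) M N, push T.inc ξ = 0) ∧
      ∀ ξ : Ext U' (n + 1) (F.obj M) (F.obj N), push (F.map T.inc) ξ = 0)
    (n : ℕ) (M N : 𝒜) : Function.Bijective (map F hF : Ext U n M N → _) := by
  induction n generalizing M N with
  | zero =>
    constructor
    · intro ξ η e
      obtain ⟨E, rfl⟩ := mk_surjective ξ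
      obtain ⟨E', rfl⟩ := mk_surjective η
      cases E; cases E'
      exact congrArg (fun f ↦ mk (.hom f)) (F.map_injective (mk_hom_injective e))
    · intro ξ
      obtain ⟨E, rfl⟩ := mk_surjective ξ
      cases E with
      | hom f =>
        obtain ⟨f, rfl⟩ := F.map_surjective f
        exact ⟨mk (.hom f), rfl⟩
  | succ n ih =>
    obtain ⟨Q, T, hT⟩ := h N
    obtain ⟨-, -, hl⟩ := longExactSequence hU n
    obtain ⟨-, hr', hl'⟩ := longExactSequence hU' n
    constructor
    · have key : ∀ ξ : Ext U (n + 1) M N, map F hF ξ = 0 → ξ = 0 := by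
        intro ξ hξ
        obtain ⟨ζ, rfl⟩ := hl T ξ ((hT n M).1 ξ)
        rw [map_append] at hξ
        obtain ⟨ω', hω'⟩ := hr' _ _ hξ
        obtain ⟨ω, rfl⟩ := (ih M T.E).2 ω'
        rw [← (ih M Q).1 ((map_push F hF T.proj ω).trans hω'), append_push_proj]
      intro ξ η e
      refine sub_eq_zero.mp (key _ ?_)
      have e' := map_add F hF (ξ - η) η
      rw [sub_add_cancel, e] at e'
      exact right_eq_add.mp e'
    · intro ξ
      obtain ⟨ζ', rfl⟩ := hl' (T.map F hF) ξ ((hT n M).2 ξ)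
      obtain ⟨ζ, rfl⟩ := (ih M Q).2 ζ'
      exact ⟨append T ζ, map_append F hF T ζ⟩

end Ext

end Functoriality

end RelYoneda

namespace Diagram

section Construct

variable {k : Type u} [CommRing k] {C : Type u} [Category.{u} C] {A : Cᵒᵖ ⥤ AlgCat.{u} k}

/-- The ring `A(c)`. -/
abbrev ringAt (A : Cᵒᵖ ⥤ AlgCat.{u} k) (c : C) : RingCat.{u} :=
  (A ⋙ forget₂ (AlgCat.{u} k) RingCat.{u}).obj (op c)

/-- The restriction homomorphism of a diagram of algebras. -/
abbrev ringMap (A : Cᵒᵖ ⥤ AlgCat.{u} k) {c c' : C} (v : c ⟶ c') : ringAt A c' →+* ringAt A c :=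
  ((A ⋙ forget₂ (AlgCat.{u} k) RingCat.{u}).map v.op).hom

lemma ringMap_id (c : C) (r : ringAt A c) : ringMap A (𝟙 c) r = r := by
  simp [ringMap]

lemma ringMap_comp {c c' c'' : C} (v : c ⟶ c') (w : c' ⟶ c'') (r : ringAt A c'') :
    ringMap A (v ≫ w) r = ringMap A v (ringMap A w r) := by
  simp [ringMap]

/-- The restriction map of a module over a diagram. -/
def restr (M : Mod A) {c c' : C} (v : c ⟶ c') : M.obj (op c') →+ M.obj (op c) :=
  (M.map v.op).hom.toAddMonoidHom

lemma restr_smul (M : Mod A) {c c' : C} (v : c ⟶ c') (r : ringAt A c') (x : M.obj (op c')) :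
    restr M v (r • x) = ringMap A v r • restr M v x :=
  M.map_smul v.op r x

lemma restr_id (M : Mod A) {c : C} (x : M.obj (op c)) : restr M (𝟙 c) x = x := by
  have := M.map_id (op c)
  exact (congrArg (fun f ↦ f.hom x) this)

lemma restr_comp (M : Mod A) {c c' c'' : C} (v : c ⟶ c') (w : c' ⟶ c'') (x : M.obj (op c'')) :
    restr M (v ≫ w) x = restr M v (restr M w x) :=
  M.map_comp_apply w.op v.op x

lemma app_restr {M N : Mod A} (f : M ⟶ N) {c c' : C} (v : c ⟶ c') (x : M.obj (op c')) :
    f.app (op c) (restr M v x) = restr N v (f.app (op c') x) :=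
  PresheafOfModules.naturality_apply f v.op x

/-- An elementwise constructor for modules over a diagram. -/
def modMk (A : Cᵒᵖ ⥤ AlgCat.{u} k) (O : C → Type u) [∀ c, AddCommGroup (O c)]
    [∀ c, Module (ringAt A c) (O c)] (res : ∀ {c c' : C}, (c ⟶ c') → (O c' →+ O c))
    (res_smul : ∀ {c c' : C} (v : c ⟶ c') (r : ringAt A c') (x : O c'),
      res v (r • x) = ringMap A v r • res v x)
    (res_id : ∀ {c : C} (x : O c), res (𝟙 c) x = x)
    (res_comp : ∀ {c c' c'' : C} (v : c ⟶ c') (w : c' ⟶ c'') (x : O c''),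
      res (v ≫ w) x = res v (res w x)) : Mod A where
  obj c := ModuleCat.of _ (O c.unop)
  map {c c'} v := ModuleCat.ofHom
    (Y := (ModuleCat.restrictScalars ((A ⋙ forget₂ (AlgCat.{u} k) RingCat.{u}).map v).hom).obj (ModuleCat.of (ringAt A c'.unop) (O c'.unop)))
    { toFun x := res v.unop x
      map_add' := map_add _
      map_smul' r x := res_smul v.unop r x }
  map_id c := by
    ext x
    exact res_id x
  map_comp v w := by
    ext x
    exact res_comp w.unop v.unop x

/-- An elementwise constructor for morphisms of modules over a diagram. -/
def modHomMk {M N : Mod A} (f : ∀ c : C, M.obj (op c) →+ N.obj (op c))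
    (hf : ∀ (c : C) (r : ringAt A c) (x : M.obj (op c)), f c (r • x) = r • f c x)
    (hn : ∀ {c c' : C} (v : c ⟶ c') (x : M.obj (op c')),
      f c (restr M v x) = restr N v (f c' x)) : M ⟶ N where
  app c := ModuleCat.ofHom
    { toFun x := f c.unop x
      map_add' := map_add _
      map_smul' r x := hf c.unop r x }
  naturality {c c'} v := by
    ext x
    exact hn v.unop x

lemma modHom_ext {M N : Mod A} {f g : M ⟶ N}
    (h : ∀ (c : C) (x : M.obj (op c)), f.app (op c) x = g.app (op c) x) : f = g := by
  ext c x
  exact h c.unop x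

end Construct

section Exactness

variable {k : Type u} [CommRing k] {C : Type u} [Category.{u} C] {A : Cᵒᵖ ⥤ AlgCat.{u} k}

lemma shortExact_iff (S : ShortComplex (Mod A)) :
    S.ShortExact ↔ ∀ c : C, Function.Injective (S.f.app (op c)) ∧
      Function.Exact (S.f.app (op c)) (S.g.app (op c)) ∧
      Function.Surjective (S.g.app (op c)) := by
  constructor
  · intro h c
    have h' := h.map_of_exact (PresheafOfModules.evaluation _ (op c))
    exact ⟨h'.moduleCat_injective_f, (ShortComplex.ShortExact.moduleCat_exact_iff_function_exact _).mp
      h'.exact, h'.moduleCat_surjective_g⟩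
  · intro h
    have : Mono S.f := PresheafOfModules.mono_of_injective fun c ↦ (h c.unop).1
    have : Epi S.g := PresheafOfModules.epi_of_surjective fun c ↦ (h c.unop).2.2
    refine ShortComplex.ShortExact.mk' ?_ ‹_› ‹_›
    rw [ShortComplex.exact_iff_isZero_homology, IsZero.iff_id_eq_zero]
    ext c : 1
    have hc : (S.map (PresheafOfModules.evaluation _ c)).Exact :=
      (ShortComplex.ShortExact.moduleCat_exact_iff_function_exact _).mpr (h c.unop).2.1
    rw [ShortComplex.exact_iff_isZero_homology] at hc
    exact (hc.of_iso (S.mapHomologyIso (PresheafOfModules.evaluation _ c)).symm).eq_of_src _ _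

/-- A `k`-linear map between values of modules, as a morphism. -/
def linMk {M N : Mod A} {c : C} (s : M.obj (op c) →+ N.obj (op c))
    (hs : ∀ (t : k) (x : M.obj (op c)), s (structureMap A c t • x) = structureMap A c t • s x) :
    (toModuleCat A c).obj M ⟶ (toModuleCat A c).obj N :=
  ModuleCat.ofHom (X := (toModuleCat A c).obj M) (Y := (toModuleCat A c).obj N)
    { toFun x := s x
      map_add' := map_add s
      map_smul' t x := hs t x }

lemma allowable_iff {M N : Mod A} (f : M ⟶ N) :
    RelYoneda.Allowable (toModuleCat A) f ↔ ∀ c : C, ∃ s : N.obj (op c) →+ M.obj (op c),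
      (∀ (t : k) (x : N.obj (op c)), s (structureMap A c t • x) = structureMap A c t • s x) ∧
      ∀ x, f.app (op c) (s (f.app (op c) x)) = f.app (op c) x := by
  refine forall_congr' fun c ↦ ⟨fun ⟨s, hs⟩ ↦ ⟨s.hom.toAddMonoidHom, fun t x ↦ s.hom.map_smul' t x,
    fun x ↦ congr($hs x)⟩, fun ⟨s, hs, hf⟩ ↦ ⟨linMk s hs, ?_⟩⟩
  ext x
  exact hf x

end Exactness

section Coinduction

variable {k : Type u} [CommRing k] {C₁ C₂ B : Type u} [Category.{u} C₁] [Category.{u} C₂]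
  [Category.{u} B]

/-- Data which define a functor from `A₁`-modules to `A₂`-modules, whose value at `X` is given by
the products of the `X(g(a))` indexed by all arrows `a : j ⟶ d(c)`. -/
structure CoindData (A₁ : C₁ᵒᵖ ⥤ AlgCat.{u} k) (A₂ : C₂ᵒᵖ ⥤ AlgCat.{u} k) (d : C₂ ⥤ B) where
  /-- the objects of `C₁` which are attached to the arrows `j ⟶ d(c)` -/
  g (j : B) : StructuredArrow j d ⥤ C₁
  /-- the change of rings -/
  ρ (j : B) : (StructuredArrow.proj j d).op ⋙ A₂ ⟶ (g j).op ⋙ A₁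

namespace CoindData

variable {A₁ : C₁ᵒᵖ ⥤ AlgCat.{u} k} {A₂ : C₂ᵒᵖ ⥤ AlgCat.{u} k} {d : C₂ ⥤ B}
  (D : CoindData A₁ A₂ d)

/-- The object of `C₁` attached to an arrow. -/
abbrev at' {j : B} {c : C₂} (a : j ⟶ d.obj c) : C₁ := (D.g j).obj (StructuredArrow.mk a)

/-- The map of `C₁` attached to an arrow and a map of `C₂`. -/
abbrev step {j : B} {c c' : C₂} (a : j ⟶ d.obj c) (v : c ⟶ c') :
    D.at' a ⟶ D.at' (a ≫ d.map v) :=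
  (D.g j).map (StructuredArrow.mkPostcomp a v)

/-- The change of rings at an arrow. -/
def scalar {j : B} {c : C₂} (a : j ⟶ d.obj c) : ringAt A₂ c →+* ringAt A₁ (D.at' a) :=
  ((D.ρ j).app (op (StructuredArrow.mk a))).hom.toRingHom

lemma scalar_structureMap {j : B} {c : C₂} (a : j ⟶ d.obj c) (t : k) :
    D.scalar a (structureMap A₂ c t) = structureMap A₁ (D.at' a) t :=
  ((D.ρ j).app (op (StructuredArrow.mk a))).hom.commutes t

lemma ringMap_scalar {j : B} {c c' : C₂} (a : j ⟶ d.obj c) (v : c ⟶ c') (r : ringAt A₂ c') :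
    ringMap A₁ (D.step a v) (D.scalar (a ≫ d.map v) r) = D.scalar a (ringMap A₂ v r) :=
  congrArg (fun f ↦ f.hom r) ((D.ρ j).naturality (StructuredArrow.mkPostcomp a v).op).symm

lemma restr_congr (X : Mod A₁) {j : B} {c c' : C₂} {a : j ⟶ d.obj c} {b b' : j ⟶ d.obj c'}
    (x : ∀ b : j ⟶ d.obj c', X.obj (op (D.at' b))) (h : b = b')
    (φ : StructuredArrow.mk a ⟶ StructuredArrow.mk b)
    (φ' : StructuredArrow.mk a ⟶ StructuredArrow.mk b') (hφ : φ.right = φ'.right) :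
    restr X ((D.g j).map φ) (x b) = restr X ((D.g j).map φ') (x b') := by
  subst h
  rw [StructuredArrow.ext φ φ' hφ]

/-- The underlying group of the value at `c` of the module coinduced from `X`. -/
def Carrier (X : Mod A₁) (c : C₂) : Type u := ∀ (j : B) (a : j ⟶ d.obj c), X.obj (op (D.at' a))

instance (X : Mod A₁) (c : C₂) : AddCommGroup (D.Carrier X c) :=
  inferInstanceAs (AddCommGroup (∀ (j : B) (a : j ⟶ d.obj c), X.obj (op (D.at' a))))

instance (X : Mod A₁) (c : C₂) : Module (ringAt A₂ c) (D.Carrier X c) :=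
  letI (j : B) (a : j ⟶ d.obj c) : Module (ringAt A₂ c) (X.obj (op (D.at' a))) :=
    Module.compHom _ (D.scalar a)
  inferInstanceAs (Module (ringAt A₂ c) (∀ (j : B) (a : j ⟶ d.obj c), X.obj (op (D.at' a))))

/-- The coinduced module. -/
def coindObj (X : Mod A₁) : Mod A₂ :=
  modMk A₂ (D.Carrier X)
    (fun v ↦
      { toFun x j a := restr X (D.step a v) (x j (a ≫ d.map v))
        map_zero' := by
          funext j a
          exact map_zero _
        map_add' x y := by
          funext j a
          exact map_add _ _ _ })
    (fun v r x ↦ by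
      funext j a
      refine (restr_smul X (D.step a v) (D.scalar (a ≫ d.map v) r) (x j _)).trans ?_
      rw [ringMap_scalar]
      rfl)
    (fun {c} x ↦ by
      funext j a
      have h := D.restr_congr X (x j) (show a ≫ d.map (𝟙 c) = a by simp)
        (StructuredArrow.mkPostcomp a (𝟙 c)) (𝟙 _) rfl
      refine h.trans ?_
      rw [CategoryTheory.Functor.map_id, restr_id])
    (fun {c c' c''} v w x ↦ by
      funext j a
      have h := D.restr_congr X (x j) (show a ≫ d.map (v ≫ w) = (a ≫ d.map v) ≫ d.map w by simp)
        (StructuredArrow.mkPostcomp a (v ≫ w))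
        (StructuredArrow.mkPostcomp a v ≫ StructuredArrow.mkPostcomp _ w) rfl
      refine h.trans ?_
      rw [(D.g j).map_comp, restr_comp]
      rfl)

/-- The functor which sends a module to the coinduced one. -/
def coind : Mod A₁ ⥤ Mod A₂ where
  obj X := D.coindObj X
  map {X Y} f := modHomMk
    (fun c ↦
      { toFun (x : D.Carrier X c) := (fun j a ↦ f.app (op (D.at' a)) (x j a) : D.Carrier Y c)
        map_zero' := by
          funext j a
          exact map_zero _
        map_add' x y := by
          funext j a
          exact map_add _ _ _ })
    (fun c r x ↦ by
      funext j a
      exact map_smul (f.app (op (D.at' a))).hom _ _)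
    (fun v x ↦ by
      funext j a
      exact app_restr f _ _)

instance : D.coind.Additive where

lemma coind_shortExact (S : ShortComplex (Mod A₁)) (hS : S.ShortExact) :
    (S.map D.coind).ShortExact := by
  rw [shortExact_iff] at hS ⊢
  intro c
  refine ⟨fun x y h ↦ ?_, fun x ↦ ⟨fun h ↦ ?_, ?_⟩, fun x ↦ ?_⟩
  · funext j a
    exact (hS (D.at' a)).1 congr(($h : D.Carrier _ c) j a)
  · have h' (j : B) (a : j ⟶ d.obj c) := ((hS (D.at' a)).2.1 _).mp congr(($h : D.Carrier _ c) j a)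
    choose y hy using h'
    refine ⟨(y : D.Carrier _ c), ?_⟩
    funext j a
    exact hy j a
  · rintro ⟨y, rfl⟩
    funext j a
    exact (hS (D.at' a)).2.1.apply_apply_eq_zero _
  · have h' (j : B) (a : j ⟶ d.obj c) := (hS (D.at' a)).2.2 ((x : D.Carrier _ c) j a)
    choose y hy using h'
    refine ⟨(y : D.Carrier _ c), ?_⟩
    funext j a
    exact hy j a

lemma coind_exact : PreservesFiniteLimits D.coind ∧ PreservesFiniteColimits D.coind :=
  ((Functor.exact_tfae D.coind).out 0 3).mp D.coind_shortExact

instance : PreservesFiniteLimits D.coind := D.coind_exact.1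

instance : PreservesFiniteColimits D.coind := D.coind_exact.2

lemma allowable_coind ⦃X Y : Mod A₁⦄ (f : X ⟶ Y)
    (h : RelYoneda.Allowable (toModuleCat A₁) f) :
    RelYoneda.Allowable (toModuleCat A₂) (D.coind.map f) := by
  rw [allowable_iff] at h ⊢
  intro c
  choose s hs hf using h
  refine ⟨{ toFun (y : D.Carrier Y c) := (fun j a ↦ s (D.at' a) (y j a) : D.Carrier X c),
            map_zero' := ?_, map_add' x y := ?_ }, fun t y ↦ ?_, fun x ↦ ?_⟩
  · funext j a
    exact map_zero _
  · funext j a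
    exact map_add _ _ _
  · funext j a
    have h := hs (D.at' a) t ((y : D.Carrier Y c) j a)
    rw [← D.scalar_structureMap] at h
    exact h
  · funext j a
    exact hf (D.at' a) _

end CoindData

end Coinduction

section Injectives

variable {k : Type u} [CommRing k] {C : Type u} [Category.{u} C] {A : Cᵒᵖ ⥤ AlgCat.{u} k}

instance (c : C) : Algebra k (ringAt A c) := inferInstanceAs (Algebra k (A.obj (op c)))

lemma structureMap_mul (c : C) (t : k) (x : ringAt A c) : structureMap A c t * x = t • x :=
  (Algebra.smul_def (A := A.obj (op c)) t x).symm

/-- The underlying group of the value at `c` of the module coinduced from a family of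
`k`-modules. -/
def InjCarrier (A : Cᵒᵖ ⥤ AlgCat.{u} k) (W : C → ModuleCat.{u} k) (c : C) : Type u :=
  ∀ (j : C) (_ : j ⟶ c), ringAt A j →ₗ[k] W j

instance (W : C → ModuleCat.{u} k) (c : C) : AddCommGroup (InjCarrier A W c) :=
  inferInstanceAs (AddCommGroup (∀ (j : C) (_ : j ⟶ c), ringAt A j →ₗ[k] W j))

lemma InjCarrier.ext {W : C → ModuleCat.{u} k} {c : C} {φ ψ : InjCarrier A W c}
    (h : ∀ (j : C) (a : j ⟶ c) (x : ringAt A j), φ j a x = ψ j a x) : φ = ψ := by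
  funext j a
  exact LinearMap.ext (h j a)

instance (W : C → ModuleCat.{u} k) (c : C) : Module (ringAt A c) (InjCarrier A W c) where
  smul r φ := fun j a ↦ φ j a ∘ₗ LinearMap.mulRight k (ringMap A a r)
  one_smul φ := InjCarrier.ext fun j a x ↦ by
    change φ j a (x * ringMap A a 1) = _
    rw [map_one, mul_one]
  mul_smul r s φ := InjCarrier.ext fun j a x ↦ by
    change φ j a (x * ringMap A a (r * s)) = φ j a (x * ringMap A a r * ringMap A a s)
    rw [RingHom.map_mul, mul_assoc]
  smul_zero r := rfl
  smul_add r φ ψ := rfl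
  add_smul r s φ := InjCarrier.ext fun j a x ↦ by
    change φ j a (x * ringMap A a (r + s)) =
      φ j a (x * ringMap A a r) + φ j a (x * ringMap A a s)
    rw [RingHom.map_add, mul_add, map_add]
  zero_smul φ := InjCarrier.ext fun j a x ↦ by
    change φ j a (x * ringMap A a 0) = 0
    rw [RingHom.map_zero, mul_zero, map_zero]

/-- The module coinduced from a family of `k`-modules. -/
def injObj (A : Cᵒᵖ ⥤ AlgCat.{u} k) (W : C → ModuleCat.{u} k) : Mod A :=
  modMk A (InjCarrier A W)
    (fun v ↦
      { toFun φ j a := φ j (a ≫ v)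
        map_zero' := rfl
        map_add' _ _ := rfl })
    (fun v r φ ↦ InjCarrier.ext fun j a x ↦ by
      change φ j (a ≫ v) (x * ringMap A (a ≫ v) r) =
        φ j (a ≫ v) (x * ringMap A a (ringMap A v r))
      rw [ringMap_comp])
    (fun φ ↦ by
      funext j a
      exact congrArg (φ j) (Category.comp_id a))
    (fun v w φ ↦ by
      funext j a
      exact congrArg (φ j) (Category.assoc a v w).symm)

lemma restr_injObj (W : C → ModuleCat.{u} k) {c c' : C} (v : c ⟶ c') (φ : InjCarrier A W c')
    (j : C) (a : j ⟶ c) : (restr (injObj A W) v φ : InjCarrier A W c) j a = φ j (a ≫ v) := rfl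

/-- A family of `k`-linear maps `E(c) → W(c)` defines a morphism from `E` to the coinduced
module. -/
def toInjObj {E : Mod A} {W : C → ModuleCat.{u} k} (f : ∀ c, E.obj (op c) →+ W c)
    (hf : ∀ (c : C) (t : k) (x : E.obj (op c)), f c (structureMap A c t • x) = t • f c x) :
    E ⟶ injObj A W :=
  modHomMk
    (fun c ↦
      { toFun e := (fun j a ↦
          { toFun x := f j (x • restr E a e)
            map_add' x y := by rw [add_smul, map_add]
            map_smul' t x := by
              rw [← structureMap_mul, mul_smul, hf]
              rfl } :
              InjCarrier A W c)
        map_zero' := InjCarrier.ext fun j a x ↦ by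
          change f j (x • restr E a 0) = 0
          rw [map_zero, smul_zero, map_zero]
        map_add' e e' := InjCarrier.ext fun j a x ↦ by
          change f j (x • restr E a (e + e')) = f j (x • restr E a e) + f j (x • restr E a e')
          rw [map_add, smul_add, map_add] })
    (fun c r e ↦ InjCarrier.ext fun j a x ↦ by
      change f j (x • restr E a (r • e)) = f j ((x * ringMap A a r) • restr E a e)
      rw [restr_smul, smul_smul])
    (fun v e ↦ InjCarrier.ext fun j a x ↦ by
      change f j (x • restr E a (restr E v e)) = f j (x • restr E (a ≫ v) e)
      rw [restr_comp])

/-- The evaluation of the coinduced module. -/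
def injCounit (A : Cᵒᵖ ⥤ AlgCat.{u} k) (W : C → ModuleCat.{u} k) (c : C) :
    (injObj A W).obj (op c) →+ W c where
  toFun := fun φ : InjCarrier A W c ↦ φ c (𝟙 c) 1
  map_zero' := rfl
  map_add' := fun _ _ ↦ rfl

lemma injCounit_smul (W : C → ModuleCat.{u} k) (c : C) (x : ringAt A c)
    (φ : (injObj A W).obj (op c)) :
    injCounit A W c (x • φ) = (φ : InjCarrier A W c) c (𝟙 c) x := by
  change (φ : InjCarrier A W c) c (𝟙 c) (1 * ringMap A (𝟙 c) x) = _
  rw [ringMap_id, one_mul]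

lemma injCounit_structureMap (W : C → ModuleCat.{u} k) (c : C) (t : k)
    (φ : (injObj A W).obj (op c)) :
    injCounit A W c (structureMap A c t • φ) = t • injCounit A W c φ := by
  rw [injCounit_smul, ← mul_one (structureMap A c t), structureMap_mul, map_smul]
  rfl

lemma exists_retraction {N M : Mod A} (S : RelYoneda.AllowableSES (toModuleCat A) N M) (c : C) :
    ∃ r : S.E.obj (op c) →+ N.obj (op c),
      (∀ (t : k) (x : S.E.obj (op c)), r (structureMap A c t • x) = structureMap A c t • r x) ∧
      ∀ x, r (S.inc.app (op c) x) = x := by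
  obtain ⟨r, hr, h⟩ := (allowable_iff _).mp S.allowable_inc c
  exact ⟨r, hr, fun x ↦ PresheafOfModules.injective_of_mono S.inc (op c) (h x)⟩

lemma relInjective_injObj (W : C → ModuleCat.{u} k) :
    RelYoneda.RelInjective (toModuleCat A) (injObj A W) := by
  intro N M S f
  choose r hr h using exists_retraction S
  refine ⟨toInjObj
    (fun c ↦ (injCounit A W c).comp ((f.app (op c)).hom.toAddMonoidHom.comp (r c)))
    (fun c t x ↦ ?_), modHom_ext fun c e ↦ InjCarrier.ext fun j a x ↦ ?_⟩
  · change injCounit A W c (f.app (op c) (r c _)) = t • injCounit A W c (f.app (op c) (r c x))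
    rw [hr, map_smul, injCounit_structureMap]
  · change injCounit A W j (f.app (op j) (r j (x • restr S.E a (S.inc.app (op c) e)))) =
      (f.app (op c) e : InjCarrier A W c) j a x
    rw [← app_restr, ← map_smul, h, map_smul, injCounit_smul, app_restr]
    refine (congrArg (fun φ ↦ φ x) (restr_injObj W a _ j (𝟙 j))).trans ?_
    rw [Category.id_comp]

/-- An allowable short exact sequence whose first morphism has objectwise `k`-linear
retractions. -/
def sesOfRetractions {N E : Mod A} (i : N ⟶ E)
    (h : ∀ c, ∃ r : E.obj (op c) →+ N.obj (op c),
      (∀ (t : k) (x : E.obj (op c)), r (structureMap A c t • x) = structureMap A c t • r x) ∧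
      ∀ x, r (i.app (op c) x) = x) :
    RelYoneda.AllowableSES (toModuleCat A) N (cokernel i) :=
  have : Mono i := PresheafOfModules.mono_of_injective fun c x y e ↦ by
    obtain ⟨r, -, hr⟩ := h c.unop
    exact (hr x).symm.trans ((congrArg r e).trans (hr y))
  .ofCokernel i (cokernel.π i) (cokernel.condition i)
    (fun k hk ↦ ⟨cokernel.desc i k hk, cokernel.π_desc i k hk⟩) inferInstance inferInstance
    (fun c ↦ by
      obtain ⟨r, hr, h⟩ := h c
      refine ⟨linMk r hr, ?_⟩
      ext x
      exact h x)

lemma enoughRelInjectives (A : Cᵒᵖ ⥤ AlgCat.{u} k) :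
    RelYoneda.EnoughRelInjectives (toModuleCat A) := by
  intro N
  refine ⟨_, sesOfRetractions
    (toInjObj (W := fun c ↦ (toModuleCat A c).obj N) (fun c ↦ AddMonoidHom.id (N.obj (op c)))
      fun c t x ↦ rfl) fun c ↦
      ⟨injCounit A (fun c ↦ (toModuleCat A c).obj N) c, injCounit_structureMap _ c, fun x ↦ ?_⟩,
    relInjective_injObj _⟩
  change (1 : ringAt A c) • restr N (𝟙 c) x = x
  rw [one_smul, restr_id]

end Injectives

section Simplices

variable {C : Type u} [Category.{u} C]

lemma isFace_vertex {p : ℕ} (τ : ComposableArrows C p) :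
    IsFace τ (ComposableArrows.mk₀ (τ.obj 0)) (𝟙 (τ.obj 0)) := by
  refine ⟨fun _ ↦ 0, fun x y h ↦ absurd h (by omega), ComposableArrows.ext₀ rfl, ?_⟩
  exact ((Category.comp_id _).trans (τ.map_id 0)).symm

lemma isFace_succ {p : ℕ} (τ : ComposableArrows C p) {j : C} (a : j ⟶ τ.obj 0) :
    IsFace (τ.precomp a) τ a := by
  refine ⟨Fin.succ, Fin.strictMono_succ, rfl, ?_⟩
  exact (Category.comp_id a).symm

lemma precomp_map_zero_succ {p : ℕ} (τ : ComposableArrows C p) {j : C} (a : j ⟶ τ.obj 0)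
    (i : Fin (p + 1)) :
    (τ.precomp a).map (homOfLE (Fin.zero_le i.succ)) = a ≫ τ.map (homOfLE (Fin.zero_le i)) := by
  obtain ⟨_ | i, hi⟩ := i
  · exact (Category.comp_id a).symm.trans (congrArg (a ≫ ·) (τ.map_id 0).symm)
  · rfl

lemma isFace_precomp {p q : ℕ} {τ : ComposableArrows C p} {σ : ComposableArrows C q}
    {v : τ.obj 0 ⟶ σ.obj 0} (hv : IsFace τ σ v) {j : C} {a : j ⟶ τ.obj 0} {b : j ⟶ σ.obj 0}
    (h : a ≫ v = b) : IsFace (τ.precomp a) (σ.precomp b) (𝟙 j) := by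
  obtain ⟨f, hf, rfl, rfl⟩ := hv
  have hf' : StrictMono (Fin.cons 0 (Fin.succ ∘ f) : Fin (q + 2) → Fin (p + 2)) := by
    intro x y hxy
    induction y using Fin.cases with
    | zero => exact absurd hxy (Fin.not_lt_zero x)
    | succ y =>
      induction x using Fin.cases with
      | zero => exact Fin.succ_pos _
      | succ x => exact Fin.succ_lt_succ_iff.mpr (hf (Fin.succ_lt_succ_iff.mp hxy))
  refine ⟨_, hf', ?_, ?_⟩
  · refine ComposableArrows.ext_succ rfl rfl ?_
    change (τ.precomp a).map (homOfLE (Fin.zero_le (f 0).succ)) = 𝟙 _ ≫ b ≫ 𝟙 _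
    rw [precomp_map_zero_succ, Category.id_comp, Category.comp_id, ← h]
    exact congrArg (a ≫ ·) (Category.comp_id _).symm
  · exact ((Category.comp_id _).trans ((τ.precomp a).map_id 0)).symm

/-- The vertex of the subdivision given by an object. -/
def vertex (j : C) : Subdivision C := ⟨0, ComposableArrows.mk₀ j⟩

/-- The simplex obtained by adjoining an arrow to the initial vertex. -/
def cone (τ : Subdivision C) {j : C} (a : j ⟶ τ.simplex.obj 0) : Subdivision C :=
  ⟨τ.dim + 1, τ.simplex.precomp a⟩

/-- The map from a simplex to its initial vertex. -/
def toVertex (τ : Subdivision C) : τ ⟶ vertex (τ.simplex.obj 0) := ⟨𝟙 _, isFace_vertex _⟩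

/-- The map `[jτ, τ, a]`. -/
def coneProj (τ : Subdivision C) {j : C} (a : j ⟶ τ.simplex.obj 0) : cone τ a ⟶ τ :=
  ⟨a, isFace_succ _ a⟩

lemma Subdivision.hom_ext {τ σ : Subdivision C} {v w : τ ⟶ σ} (h : v.1 = w.1) : v = w :=
  Subtype.ext h

/-- The functor `(τ, a : j ⟶ τ(0)) ↦ jτ`. -/
def coneFunctor (j : C) : StructuredArrow j (Subdivision.d C) ⥤ Subdivision C where
  obj s := cone s.right s.hom
  map φ := ⟨𝟙 j, isFace_precomp φ.right.2 (StructuredArrow.w φ)⟩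
  map_id _ := rfl
  map_comp _ _ := Subdivision.hom_ext (Category.comp_id _).symm

end Simplices

section FullyFaithful

variable {k : Type u} [CommRing k] {C : Type u} [Category.{u} C] {A : Cᵒᵖ ⥤ AlgCat.{u} k}

lemma app_eq_app_vertex {M N : Mod A} (f : (dStar A).obj M ⟶ (dStar A).obj N) (τ : Subdivision C)
    (x : M.obj (op (τ.simplex.obj 0))) :
    (f.app (op τ) x : N.obj (op (τ.simplex.obj 0))) =
      f.app (op (vertex (τ.simplex.obj 0))) x := by
  have h := app_restr f (toVertex τ) x
  have h₁ : restr ((dStar A).obj M) (toVertex τ) x = x := restr_id M x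
  rw [h₁] at h
  exact h.trans (restr_id N _)

instance : (dStar A).Faithful where
  map_injective h := modHom_ext fun c x ↦ congr(($h).app (op (vertex c)) x)

instance : (dStar A).Full where
  map_surjective {M N} f := by
    refine ⟨modHomMk (fun c ↦ (f.app (op (vertex c))).hom.toAddMonoidHom)
      (fun c r x ↦ (f.app (op (vertex c))).hom.map_smul r x) (fun {c c'} v x ↦ ?_),
      modHom_ext fun τ x ↦ (app_eq_app_vertex f τ x).symm⟩
    refine (app_eq_app_vertex f (cone (vertex c') v) (restr M v x)).symm.trans ?_
    exact app_restr f (coneProj (vertex c') v) x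

end FullyFaithful

section Comparison

variable {k : Type u} [CommRing k] {C : Type u} [Category.{u} C] (A : Cᵒᵖ ⥤ AlgCat.{u} k)

variable (C) in
/-- The inclusion of the vertices. -/
def vertices : Discrete C ⥤ Subdivision C := Discrete.functor vertex

/-- The restriction of a module over the subdivision to the vertices. -/
abbrev resVertices : Mod (subdivide A) ⥤ Mod ((vertices C).op ⋙ subdivide A) :=
  pullbackFunctor (vertices C) (subdivide A)

/-- The data for the coinduction from the discrete category on the objects of `C`. -/
def discreteData : CoindData ((vertices C).op ⋙ subdivide A) A (𝟭 C) where
  g j := (Functor.const _).obj (Discrete.mk j)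
  ρ j :=
    { app s := A.map s.unop.hom.op
      naturality s s' φ := by
        refine (A.map_comp _ _).symm.trans ?_
        refine Eq.trans ?_ ((congrArg (A.map s.unop.hom.op ≫ ·)
          (((vertices C).op ⋙ subdivide A).map_id _)).trans (Category.comp_id _)).symm
        exact congrArg (fun f ↦ A.map f.op) (StructuredArrow.w φ.unop) }

/-- The data for the functor `X ↦ ∏ X(jτ)`. -/
def coneData : CoindData (subdivide A) (subdivide A) (Subdivision.d C) where
  g j := coneFunctor j
  ρ j :=
    { app s := A.map s.unop.hom.op
      naturality s s' φ := by
        refine (A.map_comp _ _).symm.trans ?_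
        refine Eq.trans ?_ (A.map_comp _ _)
        refine congrArg A.map (Quiver.Hom.unop_inj ?_)
        exact (StructuredArrow.w φ.unop).trans (Category.id_comp _).symm }

/-- The functor `M ↦ ∏ M(j)`. -/
abbrev coindVertices : Mod ((vertices C).op ⋙ subdivide A) ⥤ Mod A := (discreteData A).coind

/-- The unit of the coinduction from the discrete category. -/
def coindUnit : 𝟭 (Mod A) ⟶ (dStar A ⋙ resVertices A) ⋙ coindVertices A where
  app M := modHomMk
    (fun c ↦
      { toFun x := (fun j a ↦ restr M a x :
          (discreteData A).Carrier ((resVertices A).obj ((dStar A).obj M)) c)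
        map_zero' := by
          funext j a
          exact map_zero _
        map_add' x y := by
          funext j a
          exact map_add _ _ _ })
    (fun c r x ↦ by
      funext j a
      exact restr_smul M a r x)
    (fun v x ↦ by
      funext j a
      refine (restr_comp M a v x).symm.trans (Eq.symm ?_)
      exact restr_id M _)
  naturality M N f := modHom_ext fun c x ↦ by
    funext j a
    exact (app_restr f a x).symm

/-- The natural transformation with components `X(τ) ⟶ ∏ X(jτ)`. -/
def coneUnit : 𝟭 (Mod (subdivide A)) ⟶ (coneData A).coind where
  app X := modHomMk
    (fun τ ↦
      { toFun x := (fun j a ↦ restr X (coneProj τ a) x : (coneData A).Carrier X τ)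
        map_zero' := by
          funext j a
          exact map_zero _
        map_add' x y := by
          funext j a
          exact map_add _ _ _ })
    (fun τ r x ↦ by
      funext j a
      exact restr_smul X (coneProj τ a) r x)
    (fun {τ σ} v x ↦ by
      funext j a
      refine (restr_comp X (coneProj τ a) v x).symm.trans ?_
      refine Eq.trans ?_ (restr_comp X ((coneData A).step a v)
        (coneProj σ (a ≫ (Subdivision.d C).map v)) x)
      exact congrArg (fun w ↦ restr X w x) (Subdivision.hom_ext (Category.id_comp _).symm))
  naturality X Y f := modHom_ext fun τ x ↦ by
    funext j a
    exact (app_restr f (coneProj τ a) x).symm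

/-- The natural transformation with components `∏ X(j) ⟶ ∏ X(jτ)`. -/
def vertexToCone : resVertices A ⋙ coindVertices A ⋙ dStar A ⟶ (coneData A).coind where
  app X := modHomMk (M := (resVertices A ⋙ coindVertices A ⋙ dStar A).obj X)
    (fun τ ↦
      { toFun (x : (discreteData A).Carrier ((resVertices A).obj X) (τ.simplex.obj 0)) :=
          (fun j a ↦ restr X (toVertex (cone τ a)) (x j a) : (coneData A).Carrier X τ)
        map_zero' := by
          funext j a
          exact map_zero _
        map_add' x y := by
          funext j a
          exact map_add _ _ _ })
    (fun τ r x ↦ by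
      funext j a
      refine (restr_smul X (toVertex (cone τ a)) _ _).trans ?_
      exact congrArg (fun s : ringAt (subdivide A) (cone τ a) ↦
        s • restr X (toVertex (cone τ a)) ((x : (discreteData A).Carrier _ _) j a))
        (ringMap_id (A := A) j _))
    (fun {τ σ} v x ↦ by
      funext j a
      let y : X.obj (op (vertex j)) :=
        (x : (discreteData A).Carrier ((resVertices A).obj X) (σ.simplex.obj 0)) j (a ≫ v.1)
      refine (congrArg (restr X (toVertex (cone τ a)))
        (restr_id ((resVertices A).obj X) (c := Discrete.mk j) y)).trans ?_
      refine Eq.trans ?_ (restr_comp X ((coneData A).step a v) (toVertex (cone σ (a ≫ v.1))) y)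
      exact congrArg (fun w ↦ restr X w y) (Subdivision.hom_ext (Category.id_comp _).symm))
  naturality X Y f := modHom_ext fun τ x ↦ by
    funext j a
    exact (app_restr f (toVertex (cone τ a)) _).symm

/-- The natural transformation with components `∏ M(jτ) = ∏ M(j)`. -/
def coneToVertex (M : Mod A) : (coneData A).coind.obj ((dStar A).obj M) ⟶
    (dStar A).obj ((coindVertices A).obj ((resVertices A).obj ((dStar A).obj M))) :=
  modHomMk (N := (dStar A).obj ((coindVertices A).obj ((resVertices A).obj ((dStar A).obj M))))
    (fun τ ↦
      { toFun (x : (coneData A).Carrier ((dStar A).obj M) τ) :=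
          (x : (discreteData A).Carrier ((resVertices A).obj ((dStar A).obj M))
            (τ.simplex.obj 0))
        map_zero' := rfl
        map_add' x y := rfl })
    (fun τ r x ↦ rfl)
    (fun {τ σ} v x ↦ by
      funext j a
      exact (restr_id M _).trans (restr_id M _).symm)

lemma coneUnit_comp_coneToVertex (M : Mod A) :
    (coneUnit A).app ((dStar A).obj M) ≫ coneToVertex A M =
      (dStar A).map ((coindUnit A).app M) := rfl

lemma coindUnit_comp_vertexToCone (M : Mod A) :
    (dStar A).map ((coindUnit A).app M) ≫ (vertexToCone A).app ((dStar A).obj M) =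
      (coneUnit A).app ((dStar A).obj M) :=
  modHom_ext fun τ x ↦ by
    funext j a
    exact restr_id M _

lemma vertexToCone_comp_coneToVertex (M : Mod A) :
    (vertexToCone A).app ((dStar A).obj M) ≫ coneToVertex A M = 𝟙 _ :=
  modHom_ext fun τ x ↦ by
    funext j a
    exact restr_id M _

variable {A}

open RelYoneda

/-- An `A`-module embeds into a module coinduced from a relatively injective module over the
vertices. -/
def coindSES {M : Mod A} {Q : Mod ((vertices C).op ⋙ subdivide A)}
    (T : AllowableSES (toModuleCat _) ((resVertices A).obj ((dStar A).obj M)) Q) :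
    AllowableSES (toModuleCat A) M
      (cokernel ((coindUnit A).app M ≫ (coindVertices A).map T.inc)) :=
  sesOfRetractions _ fun c ↦ by
    obtain ⟨r, hr, h⟩ := exists_retraction T (Discrete.mk c)
    refine ⟨r.comp
      { toFun (x : (discreteData A).Carrier T.E c) := x c (𝟙 c)
        map_zero' := rfl
        map_add' x y := rfl }, fun t x ↦ ?_, fun x ↦ ?_⟩
    · let y : T.E.obj (op (Discrete.mk c)) := (x : (discreteData A).Carrier T.E c) c (𝟙 c)
      refine Eq.trans (congrArg r ?_) (hr t y)
      exact congrArg (fun s : ringAt ((vertices C).op ⋙ subdivide A) (Discrete.mk c) ↦ s • y)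
        (CoindData.scalar_structureMap (discreteData A) (𝟙 c) t)
    · exact (h _).trans (restr_id M x)

lemma allowable_coindVertices_comp ⦃X Y : Mod ((vertices C).op ⋙ subdivide A)⦄ (f : X ⟶ Y)
    (h : Allowable (toModuleCat _) f) :
    Allowable (toModuleCat _) ((coindVertices A ⋙ dStar A).map f) :=
  allowable_pullbackFunctor _ _ _ ((discreteData A).allowable_coind f h)

lemma push_coindSES {M N : Mod A} {Q : Mod ((vertices C).op ⋙ subdivide A)}
    (T : AllowableSES (toModuleCat _) ((resVertices A).obj ((dStar A).obj N)) Q)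
    (hT : RelInjective (toModuleCat _) T.E) {n : ℕ} (ξ : Ext A (n + 1) M N) :
    Ext.push (coindSES T).inc ξ = 0 := by
  have hr : ∀ ⦃X Y : Mod A⦄ (f : X ⟶ Y), Allowable (toModuleCat A) f →
      Allowable (toModuleCat _) ((dStar A ⋙ resVertices A).map f) := fun _ _ _ h ↦
    allowable_pullbackFunctor _ _ _ (allowable_pullbackFunctor _ _ _ h)
  have hrK : ∀ ⦃X Y : Mod A⦄ (f : X ⟶ Y), Allowable (toModuleCat A) f →
      Allowable (toModuleCat _) (((dStar A ⋙ resVertices A) ⋙ coindVertices A).map f) :=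
    fun _ _ f h ↦ (discreteData A).allowable_coind _ (hr f h)
  have e := Ext.push_app_map (hF := fun _ _ _ h ↦ h) (hG := hrK) (coindUnit A) ξ
  rw [Ext.map_id] at e
  change Ext.push ((coindUnit A).app N ≫ (coindVertices A).map T.inc) ξ = 0
  rw [← Ext.push_push]
  refine (congrArg (Ext.push ((coindVertices A).map T.inc)) e).trans ?_
  rw [Ext.push_pull, Ext.map_comp _ hr _ (discreteData A).allowable_coind]
  refine (congrArg (Ext.pull _) (Ext.map_push _ _ T.inc _).symm).trans ?_
  rw [hT.ext_eq_zero (Ext.push T.inc _), Ext.map_zero, Ext.pull_map_zero]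

lemma push_coindUnit {M N : Mod A} {n : ℕ}
    (ξ : Ext (subdivide A) n ((dStar A).obj M) ((dStar A).obj N)) :
    Ext.push ((dStar A).map ((coindUnit A).app N)) ξ =
      Ext.pull ((dStar A).map ((coindUnit A).app M))
        (Ext.map (coindVertices A ⋙ dStar A) allowable_coindVertices_comp
          (Ext.map (resVertices A) (allowable_pullbackFunctor _ _) ξ)) := by
  have e := Ext.push_app_map (hF := fun _ _ _ h ↦ h) (hG := (coneData A).allowable_coind)
    (coneUnit A) ξ
  have hr : ∀ ⦃X Y : Mod (subdivide A)⦄ (f : X ⟶ Y), Allowable (toModuleCat _) f →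
      Allowable (toModuleCat _) ((resVertices A ⋙ coindVertices A ⋙ dStar A).map f) :=
    fun _ _ f h ↦ allowable_coindVertices_comp _ (allowable_pullbackFunctor _ _ f h)
  have e' := Ext.push_app_map (hF := hr) (hG := (coneData A).allowable_coind) (vertexToCone A) ξ
  rw [Ext.map_id] at e
  rw [Ext.map_comp (resVertices A) (allowable_pullbackFunctor _ _) _
    allowable_coindVertices_comp] at e'
  rw [← coneUnit_comp_coneToVertex, ← Ext.push_push]
  refine (congrArg _ e).trans ?_
  rw [← coindUnit_comp_vertexToCone, ← Ext.pull_pull, ← e', Ext.push_pull, Ext.push_push,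
    vertexToCone_comp_coneToVertex, Ext.push_id]

lemma push_dStar_coindSES {M N : Mod A} {Q : Mod ((vertices C).op ⋙ subdivide A)}
    (T : AllowableSES (toModuleCat _) ((resVertices A).obj ((dStar A).obj N)) Q)
    (hT : RelInjective (toModuleCat _) T.E) {n : ℕ}
    (ξ : Ext (subdivide A) (n + 1) ((dStar A).obj M) ((dStar A).obj N)) :
    Ext.push ((dStar A).map (coindSES T).inc) ξ = 0 := by
  change Ext.push ((dStar A).map ((coindUnit A).app N ≫ (coindVertices A).map T.inc)) ξ = 0
  rw [Functor.map_comp, ← Ext.push_push, push_coindUnit, Ext.push_pull]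
  refine (congrArg (Ext.pull _) (Ext.map_push (coindVertices A ⋙ dStar A)
    allowable_coindVertices_comp T.inc _).symm).trans ?_
  rw [hT.ext_eq_zero (Ext.push T.inc _), Ext.map_zero, Ext.pull_map_zero]

variable (A) in
/-- The functor `d^*` induces bijections on relative Yoneda cohomology. -/
lemma extSubdivide_bijective (n : ℕ) (M N : Mod A) :
    Function.Bijective (extSubdivide A n M N) :=
  Ext.map_bijective (dStar A) (allowable_pullbackFunctor (Subdivision.d C) A)
    (enoughRelInjectives A) (enoughRelInjectives _)
    (fun N ↦ by
      obtain ⟨Q, T, hT⟩ := enoughRelInjectives _ ((resVertices A).obj ((dStar A).obj N))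
      exact ⟨_, coindSES T, fun n M ↦ ⟨push_coindSES T hT, push_dStar_coindSES T hT⟩⟩) n M N

lemma extSubdivide_smul (n : ℕ) (M N : Mod A) (t : k) (ξ : Ext A n M N) :
    extSubdivide A n M N (t • ξ) = t • extSubdivide A n M N ξ :=
  Ext.map_push (dStar A) (allowable_pullbackFunctor (Subdivision.d C) A) (t • 𝟙 N) ξ

end Comparison

end Diagram

end

theorem corollary3p10 {k : Type u} [CommRing k] {C : Type u} [CategoryTheory.SmallCategory C]
    (A : Cᵒᵖ ⥤ AlgCat.{u} k) :
    ∃ φ : ∀ (n : ℕ) (M N : Diagram.Mod A), Diagram.Ext A n M N ≃ₗ[k]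
        Diagram.Ext (Diagram.subdivide A) n ((Diagram.dStar A).obj M) ((Diagram.dStar A).obj N),
      (∀ (n : ℕ) (M N : Diagram.Mod A) (ξ : Diagram.Ext A n M N),
        φ n M N ξ = Diagram.extSubdivide A n M N ξ) ∧
      (∀ (n : ℕ) {M M' : Diagram.Mod A} (N : Diagram.Mod A) (β : M' ⟶ M)
        (ξ : Diagram.Ext A n M N),
        φ n M' N (RelYoneda.Ext.pull β ξ) =
          RelYoneda.Ext.pull ((Diagram.dStar A).map β) (φ n M N ξ)) ∧
      (∀ (n : ℕ) (M : Diagram.Mod A) {N N' : Diagram.Mod A} (α : N ⟶ N')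
        (ξ : Diagram.Ext A n M N),
        φ n M N' (RelYoneda.Ext.push α ξ) =
          RelYoneda.Ext.push ((Diagram.dStar A).map α) (φ n M N ξ)) := by
  refine ⟨fun n M N ↦ LinearEquiv.ofBijective
    { toFun := Diagram.extSubdivide A n M N
      map_add' := RelYoneda.Ext.map_add _ _
      map_smul' := Diagram.extSubdivide_smul n M N }
    (Diagram.extSubdivide_bijective A n M N), fun n M N ξ ↦ rfl, ?_, ?_⟩
  · exact fun n M M' N β ξ ↦ RelYoneda.Ext.map_pull _ _ β ξ
  · exact fun n M N N' α ξ ↦ RelYoneda.Ext.map_push _ _ α ξ
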